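/- Let $(M,g)$ be a smooth Riemannian manifold and $T$ a smooth 3-form on $M$. Let $C(M)=M\times(0,\infty)$ with radial coordinate $r$ and cone metric $\bar g=dr^2+r^2g$. Call $(M,g,T)$ a *Sasaki with torsion (ST) manifold* if $C(M)$ carries a complex structure $J$ (a smooth almost complex structure with vanishing Nijenhuis tensor) such that $\bar g(JX,JY)=\bar g(X,Y)$ and the Bismut torsion of $(\bar g,J)$ is $B=r^2T$ ($T$ pulled back to $C(M)$). That is, there is a connection $\bar\nabla$ on the tangent bundle of $C(M)$ with $\bar\nabla\bar g=0$, $\bar\nabla J=0$ whose torsion satisfies $\bar g(\bar\nabla_XY-\bar\nabla_YX-[X,Y],Z)=r^2T(X,Y,Z)$. For a smooth vector field $\xi$, 1-form $\eta$ and $(1,1)$-tensor field $\Phi$ on $M$, put $\omega(X,Y)=g(\Phi X,Y)$, $N_\Phi(X,Y)=[\Phi X,\Phi Y]+\Phi^2[X,Y]-\Phi[X,\Phi Y]-\Phi[\Phi X,Y]$ and $d^T\eta(X,Y)=d\eta(X,Y)-T(\eta^\sharp,X,Y)$, where $\eta^\sharp$ is the vector field $g$-dual to $\eta$ and $d\eta(X,Y)=X\eta(Y)-Y\eta(X)-\eta([X,Y])$.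 Call $(g,\xi,\eta,\Phi,T)$ a *normal T-contact metric structure* if - $\eta(\xi)=1$, $\ \Phi^2X=-X+\eta(X)\xi$, $\ g(\Phi X,\Phi Y)=g(X,Y)-\eta(X)\eta(Y)$; - $d^T\eta=2\omega$, $\ \xi\lrcorner d\omega=0$, and $T(X,Y,Z)=T(X,\Phi Y,\Phi Z)+T(\Phi X,Y,\Phi Z)+T(\Phi X,\Phi Y,Z)$; - $N_\Phi(X,Y)+d\eta(X,Y)\,\xi=0$. Its torsion restricted to $\mathcal D=\ker\eta$ is a *Bismut torsion* if, with $J_{\mathcal D}=\Phi|_{\mathcal D}$, $$T(X,Y,Z)=d\omega(J_{\mathcal D}X,J_{\mathcal D}Y,J_{\mathcal D}Z)\qquad\text{for all }X,Y,Z\in\mathcal D .$$ **Proposition.** $(M,g,T)$ is an ST manifold if and only if there are $\xi,\eta,\Phi$ such that $(g,\xi,\eta,\Phi,T)$ is a normal T-contact metric structure whose torsion restricted to $\mathcal D$ is a Bismut torsion. More precisely, an endomorphism field $J$ of the tangent bundle of $C(M)$ makes $(C(M),\bar g,J)$ Kähler with torsion with Bismut torsion $r^2T$ in the above sense if and only if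 there is such a triple $(\xi,\eta,\Phi)$ with $J(r\partial_r)=\xi$ and $J(X)=\Phi(X)-r\eta(X)\partial_r$ for $X$ tangent to $M$. -/

import Mathlib

open Bundle Manifold VectorField
open scoped ContDiff

noncomputable section

namespace STGeom

/-! ## Tensor fields on a manifold

All tensor fields are families of (multi)linear maps on the tangent spaces.  Identities between
tensors that involve derivatives are stated at each point `x` for all vector fields that are
differentiable at `x`; both sides depend only on the values of the fields at `x`. -/

section General

variable {E : Type*} [NormedAddCommGroup E] [NormedSpace ℝ E]
  {H : Type*} [TopologicalSpace H] (I : ModelWithCorners ℝ E H)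
  {M : Type*} [TopologicalSpace M] [ChartedSpace H M] [IsManifold I ∞ M]

/-- `X` is differentiable at `x`, as a section of the tangent bundle. -/
def DiffAt (X : Π y : M, TangentSpace I y) (x : M) : Prop :=
  MDifferentiableAt I I.tangent (fun y ↦ (⟨y, X y⟩ : TangentBundle I M)) x

/-- Exterior derivative of a 1-form, evaluated on vector fields:
`dη(X,Y) = X η(Y) - Y η(X) - η([X,Y])`. -/
def extDerivOne (η : Π y : M, TangentSpace I y →L[ℝ] ℝ)
    (X Y : Π y : M, TangentSpace I y) (x : M) : ℝ :=
  mvfderiv I (fun y ↦ η y (Y y)) x (X x) - mvfderiv I (fun y ↦ η y (X y)) x (Y x)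
    - η x (mlieBracket I X Y x)

/-- Exterior derivative of a 2-form, evaluated on vector fields:
`dβ(X,Y,Z) = X β(Y,Z) - Y β(X,Z) + Z β(X,Y) - β([X,Y],Z) + β([X,Z],Y) - β([Y,Z],X)`. -/
def extDerivTwo (β : Π y : M, TangentSpace I y →L[ℝ] TangentSpace I y →L[ℝ] ℝ)
    (X Y Z : Π y : M, TangentSpace I y) (x : M) : ℝ :=
  mvfderiv I (fun y ↦ β y (Y y) (Z y)) x (X x)
    - mvfderiv I (fun y ↦ β y (X y) (Z y)) x (Y x)
    + mvfderiv I (fun y ↦ β y (X y) (Y y)) x (Z x)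
    - β x (mlieBracket I X Y x) (Z x)
    + β x (mlieBracket I X Z x) (Y x)
    - β x (mlieBracket I Y Z x) (X x)

/-- The Nijenhuis tensor of an endomorphism field, evaluated on vector fields:
`N_Φ(X,Y) = [ΦX, ΦY] + Φ²[X,Y] - Φ[X, ΦY] - Φ[ΦX, Y]`. -/
def nijenhuis (Φ : Π y : M, TangentSpace I y →L[ℝ] TangentSpace I y)
    (X Y : Π y : M, TangentSpace I y) (x : M) : TangentSpace I x :=
  mlieBracket I (fun y ↦ Φ y (X y)) (fun y ↦ Φ y (Y y)) x
    + Φ x (Φ x (mlieBracket I X Y x))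
    - Φ x (mlieBracket I X (fun y ↦ Φ y (Y y)) x)
    - Φ x (mlieBracket I (fun y ↦ Φ y (X y)) Y x)

/-- The fundamental 2-form `ω(X,Y) = h(ΦX, Y)`. -/
def fundamentalForm (h : Π y : M, TangentSpace I y →L[ℝ] TangentSpace I y →L[ℝ] ℝ)
    (Φ : Π y : M, TangentSpace I y →L[ℝ] TangentSpace I y) :
    Π y : M, TangentSpace I y →L[ℝ] TangentSpace I y →L[ℝ] ℝ :=
  fun y ↦ (h y).comp (Φ y)

/-- A covariant 3-tensor field is totally skew-symmetric. -/
def TotallySkew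
    (B : Π y : M, TangentSpace I y →L[ℝ] TangentSpace I y →L[ℝ] TangentSpace I y →L[ℝ] ℝ) :
    Prop :=
  (∀ x (u v w : TangentSpace I x), B x u v w = -B x v u w) ∧
    ∀ x (u v w : TangentSpace I x), B x u v w = -B x u w v

/-- An endomorphism field of the tangent bundle is smooth. -/
def SmoothEndo (Φ : Π y : M, TangentSpace I y →L[ℝ] TangentSpace I y) : Prop :=
  ContMDiff I (I.prod 𝓘(ℝ, E →L[ℝ] E)) ∞
    (fun y ↦ TotalSpace.mk' (E →L[ℝ] E)
      (E := fun y : M ↦ TangentSpace I y →L[ℝ] TangentSpace I y) y (Φ y))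

/-- `X` is smooth at `x`, as a section of the tangent bundle. -/
def SmoothAt (X : Π y : M, TangentSpace I y) (x : M) : Prop :=
  ContMDiffAt I I.tangent ∞ (fun y ↦ (⟨y, X y⟩ : TangentBundle I M)) x

variable (M) in
/-- Smooth differential 3-forms: totally skew-symmetric, and smooth in the sense that
`T(X,Y,Z)` is smooth wherever the vector fields `X`, `Y`, `Z` are smooth. -/
structure ThreeForm where
  /-- The value of the form at a point. -/
  toFun : Π y : M, TangentSpace I y →L[ℝ] TangentSpace I y →L[ℝ] TangentSpace I y →L[ℝ] ℝ
  skew : TotallySkew I toFun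
  smooth : ∀ x (X Y Z : Π y : M, TangentSpace I y),
    SmoothAt I X x → SmoothAt I Y x → SmoothAt I Z x →
    ContMDiffAt I 𝓘(ℝ, ℝ) ∞ (fun y ↦ toFun y (X y) (Y y) (Z y)) x

/-- A complex structure: a smooth almost complex structure that is integrable, i.e. whose
Nijenhuis tensor vanishes. -/
structure IsComplexStructure (J : Π y : M, TangentSpace I y →L[ℝ] TangentSpace I y) : Prop where
  smooth : SmoothEndo I J
  sq : ∀ x (v : TangentSpace I x), J x (J x v) = -v
  integrable : ∀ x (X Y : Π y : M, TangentSpace I y), DiffAt I X x → DiffAt I Y x →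
    nijenhuis I J X Y x = 0

variable [FiniteDimensional ℝ E]

/-- `B` is the Bismut torsion of the Hermitian structure `(h, J)`: it is totally skew-symmetric and
it is the torsion, with its index lowered by `h`, of a connection `∇` on the tangent bundle with
`∇h = 0` and `∇J = 0`.  (Here `cov Y x u` is `∇_u Y` at `x`, and the torsion is
`∇_X Y - ∇_Y X - [X,Y]`.) -/
def IsBismutTorsion (h : Π y : M, TangentSpace I y →L[ℝ] TangentSpace I y →L[ℝ] ℝ)
    (J : Π y : M, TangentSpace I y →L[ℝ] TangentSpace I y)
    (B : Π y : M, TangentSpace I y →L[ℝ] TangentSpace I y →L[ℝ] TangentSpace I y →L[ℝ] ℝ) :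
    Prop :=
  TotallySkew I B ∧
  ∃ cov : CovariantDerivative I E (fun y : M ↦ TangentSpace I y),
    (∀ x (Y Z : Π y : M, TangentSpace I y), DiffAt I Y x → DiffAt I Z x →
      ∀ u : TangentSpace I x,
        mvfderiv I (fun y ↦ h y (Y y) (Z y)) x u
          = h x (cov Y x u) (Z x) + h x (Y x) (cov Z x u)) ∧
    (∀ x (Y : Π y : M, TangentSpace I y), DiffAt I Y x → ∀ u : TangentSpace I x,
        cov (fun y ↦ J y (Y y)) x u = J x (cov Y x u)) ∧
    ∀ x (u v w : TangentSpace I x), h x (cov.torsion x u v) w = B x u v w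

/-- `(h, J, B)` is a Kähler-with-torsion structure: `J` is a complex structure, `h` is
`J`-Hermitian, and `B` is the Bismut torsion of `(h, J)`. -/
structure IsKT (h : Π y : M, TangentSpace I y →L[ℝ] TangentSpace I y →L[ℝ] ℝ)
    (J : Π y : M, TangentSpace I y →L[ℝ] TangentSpace I y)
    (B : Π y : M, TangentSpace I y →L[ℝ] TangentSpace I y →L[ℝ] TangentSpace I y →L[ℝ] ℝ) :
    Prop where
  complex : IsComplexStructure I J
  hermitian : ∀ x (u v : TangentSpace I x), h x (J x u) (J x v) = h x u v
  bismut : IsBismutTorsion I h J B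

end General

/-! ## The metric cone -/

/-- The half line `(0, ∞)` as an open submanifold of `ℝ`. -/
def posReals : TopologicalSpace.Opens ℝ := ⟨Set.Ioi 0, isOpen_Ioi⟩

section Cone

variable {E : Type*} [NormedAddCommGroup E] [NormedSpace ℝ E]
  {H : Type*} [TopologicalSpace H] (I : ModelWithCorners ℝ E H)
  {M : Type*} [TopologicalSpace M] [ChartedSpace H M]

variable (M) in
/-- The cone manifold `C(M) = M × (0, ∞)`. -/
abbrev Cone := M × posReals

/-- The model of the cone manifold. -/
abbrev coneModel : ModelWithCorners ℝ (E × ℝ) (ModelProd H ℝ) := I.prod 𝓘(ℝ, ℝ)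

/-- The radial coordinate `r`. -/
def radius (p : Cone M) : ℝ := p.2

/-- The differential `dr` of the radial coordinate. -/
def dr (p : Cone M) : TangentSpace (coneModel I) p →L[ℝ] ℝ :=
  mvfderiv (coneModel I) (radius : Cone M → ℝ) p

/-- The differential of the projection `C(M) → M`. -/
def dproj (p : Cone M) : TangentSpace (coneModel I) p →L[ℝ] TangentSpace I p.1 :=
  mfderiv (coneModel I) I (Prod.fst : Cone M → M) p

/-- The cone metric `dr² + r² g`. -/
def coneMetric (g : Π y : M, TangentSpace I y →L[ℝ] TangentSpace I y →L[ℝ] ℝ) (p : Cone M) :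
    TangentSpace (coneModel I) p →L[ℝ] TangentSpace (coneModel I) p →L[ℝ] ℝ :=
  (dr I p).smulRight (dr I p) +
    (radius p ^ 2) • ((dproj I p).precomp ℝ).comp ((g p.1).comp (dproj I p))

lemma coneMetric_apply (g : Π y : M, TangentSpace I y →L[ℝ] TangentSpace I y →L[ℝ] ℝ)
    (p : Cone M) (u v : TangentSpace (coneModel I) p) :
    coneMetric I g p u v
      = dr I p u * dr I p v + radius p ^ 2 * g p.1 (dproj I p u) (dproj I p v) := rfl

/-- The 3-tensor `r² T` on the cone, where `T` is pulled back along the projection `C(M) → M`. -/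
def coneTorsion
    (T : Π y : M, TangentSpace I y →L[ℝ] TangentSpace I y →L[ℝ] TangentSpace I y →L[ℝ] ℝ)
    (p : Cone M) :
    TangentSpace (coneModel I) p →L[ℝ] TangentSpace (coneModel I) p →L[ℝ]
      TangentSpace (coneModel I) p →L[ℝ] ℝ :=
  (radius p ^ 2) •
    ((((dproj I p).precomp ℝ).postcomp (TangentSpace (coneModel I) p)).comp
      ((dproj I p).precomp (TangentSpace I p.1 →L[ℝ] ℝ))).comp ((T p.1).comp (dproj I p))

lemma coneTorsion_apply
    (T : Π y : M, TangentSpace I y →L[ℝ] TangentSpace I y →L[ℝ] TangentSpace I y →L[ℝ] ℝ)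
    (p : Cone M) (u v w : TangentSpace (coneModel I) p) :
    coneTorsion I T p u v w
      = radius p ^ 2 * T p.1 (dproj I p u) (dproj I p v) (dproj I p w) := rfl

end Cone

/-! ## Sasaki-with-torsion manifolds and T-contact metric structures -/

section Contact

variable {E : Type*} [NormedAddCommGroup E] [NormedSpace ℝ E] [FiniteDimensional ℝ E]
  {H : Type*} [TopologicalSpace H] {I : ModelWithCorners ℝ E H}
  {M : Type*} [TopologicalSpace M] [ChartedSpace H M] [IsManifold I ∞ M]

/-- `J` makes the metric cone of `(M, g)` a Kähler-with-torsion manifold whose Bismut torsion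
is `r² T`. -/
def IsSTConeStructure (g : ContMDiffRiemannianMetric I ∞ E (fun y : M ↦ TangentSpace I y))
    (T : ThreeForm I M)
    (J : Π p : Cone M, TangentSpace (coneModel I) p →L[ℝ] TangentSpace (coneModel I) p) : Prop :=
  IsKT (coneModel I) (coneMetric I g.inner) J (coneTorsion I T.toFun)

/-- `(M, g, T)` is a Sasaki-with-torsion (ST) manifold. -/
def IsSTManifold (g : ContMDiffRiemannianMetric I ∞ E (fun y : M ↦ TangentSpace I y))
    (T : ThreeForm I M) : Prop :=
  ∃ J : Π p : Cone M, TangentSpace (coneModel I) p →L[ℝ] TangentSpace (coneModel I) p,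
    IsSTConeStructure g T J

variable (I M) in
/-- A smooth vector field `ξ`, a smooth 1-form `η` and a smooth endomorphism field `Φ`. -/
structure ContactTriple where
  /-- The vector field. -/
  ξ : Π y : M, TangentSpace I y
  /-- The 1-form. -/
  η : Π y : M, TangentSpace I y →L[ℝ] ℝ
  /-- The endomorphism field. -/
  Φ : Π y : M, TangentSpace I y →L[ℝ] TangentSpace I y
  smooth_ξ : ContMDiff I I.tangent ∞ (fun y ↦ (⟨y, ξ y⟩ : TangentBundle I M))
  smooth_η : ContMDiff I (I.prod 𝓘(ℝ, E →L[ℝ] ℝ)) ∞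
    (fun y ↦ TotalSpace.mk' (E →L[ℝ] ℝ) (E := fun y : M ↦ TangentSpace I y →L[ℝ] ℝ) y (η y))
  smooth_Φ : SmoothEndo I Φ

/-- `(g, ξ, η, Φ)` is an almost contact metric structure. -/
structure IsAlmostContactMetric
    (g : ContMDiffRiemannianMetric I ∞ E (fun y : M ↦ TangentSpace I y))
    (S : ContactTriple I M) : Prop where
  eta_xi : ∀ x, S.η x (S.ξ x) = 1
  phi_sq : ∀ x (u : TangentSpace I x), S.Φ x (S.Φ x u) = -u + S.η x u • S.ξ x
  metric : ∀ x (u v : TangentSpace I x),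
    g.inner x (S.Φ x u) (S.Φ x v) = g.inner x u v - S.η x u * S.η x v

/-- Normality: `N_Φ + dη ⊗ ξ = 0`. -/
def IsNormal (S : ContactTriple I M) : Prop :=
  ∀ x (X Y : Π y : M, TangentSpace I y), DiffAt I X x → DiffAt I Y x →
    nijenhuis I S.Φ X Y x + extDerivOne I S.η X Y x • S.ξ x = 0

lemma exists_sharp (g : ContMDiffRiemannianMetric I ∞ E (fun y : M ↦ TangentSpace I y)) (x : M)
    (α : TangentSpace I x →L[ℝ] ℝ) :
    ∃ v : TangentSpace I x, ∀ w : TangentSpace I x, g.inner x v w = α w := by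
  have : FiniteDimensional ℝ (TangentSpace I x) := inferInstanceAs (FiniteDimensional ℝ E)
  let f : TangentSpace I x →ₗ[ℝ] Module.Dual ℝ (TangentSpace I x) := (g.inner x).toBilinForm
  have hinj : Function.Injective f := by
    rw [injective_iff_map_eq_zero]
    intro v hv
    by_contra h
    have h1 : g.inner x v v = 0 := LinearMap.congr_fun hv v
    exact (g.pos x v h).ne' h1
  obtain ⟨v, hv⟩ := (LinearMap.injective_iff_surjective_of_finrank_eq_finrank
    Subspace.dual_finrank_eq.symm).1 hinj α.toLinearMap
  exact ⟨v, fun w ↦ LinearMap.congr_fun hv w⟩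

/-- The vector `α♯` that is `g`-dual to a covector `α`, i.e. `g(α♯, w) = α(w)`. -/
def sharp (g : ContMDiffRiemannianMetric I ∞ E (fun y : M ↦ TangentSpace I y)) (x : M)
    (α : TangentSpace I x →L[ℝ] ℝ) : TangentSpace I x :=
  Classical.choose (exists_sharp g x α)

lemma inner_sharp (g : ContMDiffRiemannianMetric I ∞ E (fun y : M ↦ TangentSpace I y)) (x : M)
    (α : TangentSpace I x →L[ℝ] ℝ) (w : TangentSpace I x) :
    g.inner x (sharp g x α) w = α w :=
  Classical.choose_spec (exists_sharp g x α) w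

/-- The torsion-deformed exterior derivative of a 1-form,
`d^T η = ∑ₐ eᵃ ∧ ∇^T_{eₐ} η = dη - ∑ₐ (eₐ ⌟ T) ∧ (eₐ ⌟ η) = dη - η♯ ⌟ T`,
where `(eₐ)` is an orthonormal frame, so that `∑ₐ η(eₐ) eₐ = η♯`. -/
def torsionDerivOne (g : ContMDiffRiemannianMetric I ∞ E (fun y : M ↦ TangentSpace I y))
    (T : ThreeForm I M) (η : Π y : M, TangentSpace I y →L[ℝ] ℝ)
    (X Y : Π y : M, TangentSpace I y) (x : M) : ℝ :=
  extDerivOne I η X Y x - T.toFun x (sharp g x (η x)) (X x) (Y x)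

/-- `(g, ξ, η, Φ, T)` is a T-contact metric structure: an almost contact metric structure with
fundamental 2-form `ω` such that `d^T η = 2 ω`, `ξ ⌟ dω = 0`, and `T` satisfies
`T(X,Y,Z) = T(X,ΦY,ΦZ) + T(ΦX,Y,ΦZ) + T(ΦX,ΦY,Z)`. -/
structure IsTContactMetric
    (g : ContMDiffRiemannianMetric I ∞ E (fun y : M ↦ TangentSpace I y))
    (T : ThreeForm I M) (S : ContactTriple I M) : Prop where
  almostContact : IsAlmostContactMetric g S
  torsionDeriv_eta : ∀ x (X Y : Π y : M, TangentSpace I y), DiffAt I X x → DiffAt I Y x →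
    torsionDerivOne g T S.η X Y x = 2 * fundamentalForm I g.inner S.Φ x (X x) (Y x)
  xi_contract : ∀ x (Y Z : Π y : M, TangentSpace I y), DiffAt I Y x → DiffAt I Z x →
    extDerivTwo I (fundamentalForm I g.inner S.Φ) S.ξ Y Z x = 0
  torsion_type : ∀ x (u v w : TangentSpace I x),
    T.toFun x u v w = T.toFun x u (S.Φ x v) (S.Φ x w) + T.toFun x (S.Φ x u) v (S.Φ x w)
      + T.toFun x (S.Φ x u) (S.Φ x v) w

/-- The restriction of `T` to `𝒟 = ker η` is a Bismut torsion:
`T(X,Y,Z) = dω(J_𝒟 X, J_𝒟 Y, J_𝒟 Z)` for `X, Y, Z ∈ 𝒟`, where `J_𝒟 = Φ|_𝒟`. -/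
def HasBismutTorsionOnContact
    (g : ContMDiffRiemannianMetric I ∞ E (fun y : M ↦ TangentSpace I y))
    (T : ThreeForm I M) (S : ContactTriple I M) : Prop :=
  ∀ x (X Y Z : Π y : M, TangentSpace I y), DiffAt I X x → DiffAt I Y x → DiffAt I Z x →
    S.η x (X x) = 0 → S.η x (Y x) = 0 → S.η x (Z x) = 0 →
    T.toFun x (X x) (Y x) (Z x)
      = extDerivTwo I (fundamentalForm I g.inner S.Φ)
          (fun y ↦ S.Φ y (X y)) (fun y ↦ S.Φ y (Y y)) (fun y ↦ S.Φ y (Z y)) x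

/-- `(g, ξ, η, Φ, T)` is a normal T-contact metric structure whose torsion restricted to `ker η`
is a Bismut torsion. -/
def IsNormalTContactBismut
    (g : ContMDiffRiemannianMetric I ∞ E (fun y : M ↦ TangentSpace I y))
    (T : ThreeForm I M) (S : ContactTriple I M) : Prop :=
  IsTContactMetric g T S ∧ IsNormal S ∧ HasBismutTorsionOnContact g T S

/-- The endomorphism field `J` of the cone corresponds to `(ξ, η, Φ)`: one has `J(r ∂_r) = ξ` and
`J(X) = Φ(X) - r η(X) ∂_r` for `X` tangent to `M`.  A tangent vector `v` of the cone has
the components `dproj v` along `M` and `dr v` along `∂_r`. -/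
def InducesOnCone (S : ContactTriple I M)
    (J : Π p : Cone M, TangentSpace (coneModel I) p →L[ℝ] TangentSpace (coneModel I) p) : Prop :=
  ∀ (p : Cone M) (v : TangentSpace (coneModel I) p),
    dproj I p (J p v) = S.Φ p.1 (dproj I p v) + (dr I p v / radius p) • S.ξ p.1 ∧
    dr I p (J p v) = -(radius p * S.η p.1 (dproj I p v))

end Contact

end STGeom

end

/-!
The triple is forced by `J`: since `r² T` vanishes on `∂_r`, the equation `∇J = 0` in the direction
`r ∂_r` is an ordinary differential equation for `J` along each ray. It says that the horizontal
part of `J X` is constant in `r`, its radial part is proportional to `r`, and the horizontal part of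
`J(r ∂_r)` is constant (`IsSTConeStructure.dEnd_radial`). So `J` has the shape
`J(r ∂_r) = ξ`, `J X = Φ X - r η(X) ∂_r` (`IsSTConeStructure.exists_inducesOnCone`).

For a `J` of this shape the two sets of conditions are compared one by one. A metric connection with
given totally skew torsion is unique by Koszul's formula, so that `(h, J)` is Kähler with torsion
`B` if and only if `J` is a Hermitian complex structure and `B = dΩ(J·, J·, J·)`, where
`Ω = h(J·, ·)` (`isKT_iff`). On the cone:

* `J² = -1` and `h(J·, J·) = h` say that `(g, ξ, η, Φ)` is almost contact metric
  (`InducesOnCone.hermitian_iff`);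
* the components of the Nijenhuis tensor of `J` are the four tensors of Sasaki and Hatakeyama, all
  of which vanish as soon as `N_Φ + dη ⊗ ξ` does (`InducesOnCone.nijenhuisAt_eq_zero_iff`);
* `dΩ = r dr ∧ θ + r² dω` with `θ = 2ω - dη`. As `J` sends `r ∂_r` to `ξ`, the equation
  `r² T = dΩ(J·, J·, J·)` splits into `ξ ⌟ T = -θ`, which is `d^T η = 2ω`, then `ξ ⌟ dω = 0`, and
  the Bismut condition on `ker η` (`InducesOnCone.torsion_eq_iff`, `torsionEquation_iff`). The type
  condition on `T` is that of the torsion of the cone, where it follows from `∇J = 0` and the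
  integrability of `J` (`IsKT.torsion_type`).

All derivatives at a point `x` are computed in the chart centred at `x`, where the frame at `x`
itself is the identity; `dVec`, `dCovec`, `dEnd`, `dForm` are the derivatives of the components in
this chart. They depend on the chart, but brackets, exterior derivatives, Nijenhuis tensors and
Koszul's formula are expressed through them.
-/

noncomputable section

namespace STGeom

/-! ### Tensor fields in the charts centred at a point -/

section Coordinates

variable {E : Type*} [NormedAddCommGroup E] [NormedSpace ℝ E]
  {H : Type*} [TopologicalSpace H] (I : ModelWithCorners ℝ E H)
  {M : Type*} [TopologicalSpace M] [ChartedSpace H M]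
  {F₁ F₂ F₃ : Type*} [NormedAddCommGroup F₁] [NormedSpace ℝ F₁]
  [NormedAddCommGroup F₂] [NormedSpace ℝ F₂] [NormedAddCommGroup F₃] [NormedSpace ℝ F₃]

lemma mdifferentiableAt_bilin (B : F₁ →L[ℝ] F₂ →L[ℝ] F₃) {f : M → F₁} {g : M → F₂} {x : M}
    (hf : MDifferentiableAt I 𝓘(ℝ, F₁) f x) (hg : MDifferentiableAt I 𝓘(ℝ, F₂) g x) :
    MDifferentiableAt I 𝓘(ℝ, F₃) (fun y ↦ B (f y) (g y)) x := by
  have h1 : MDifferentiableAt I 𝓘(ℝ, F₂ →L[ℝ] F₃) (fun y ↦ B (f y)) x :=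
    B.differentiableAt.comp_mdifferentiableAt hf
  exact h1.clm_apply hg

lemma mvfderiv_bilin (B : F₁ →L[ℝ] F₂ →L[ℝ] F₃) {f : M → F₁} {g : M → F₂} {x : M}
    (hf : MDifferentiableAt I 𝓘(ℝ, F₁) f x) (hg : MDifferentiableAt I 𝓘(ℝ, F₂) g x)
    (u : TangentSpace I x) :
    mvfderiv I (fun y ↦ B (f y) (g y)) x u
      = B (mvfderiv I f x u) (g x) + B (f x) (mvfderiv I g x u) := by
  have hf' := hf.differentiableWithinAt_writtenInExtChartAt
  have hg' := hg.differentiableWithinAt_writtenInExtChartAt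
  have hu : UniqueDiffWithinAt ℝ (Set.range I) (extChartAt I x x) :=
    I.uniqueDiffOn _ (Set.mem_range_self _)
  have key := (B.hasFDerivWithinAt_of_bilinear hf'.hasFDerivWithinAt
    hg'.hasFDerivWithinAt).fderivWithin hu
  have e1 := congrArg (fun L : E →L[ℝ] F₃ ↦ L u) (mdifferentiableAt_bilin I B hf hg).mvfderiv
  have e2 := congrArg (fun L : E →L[ℝ] F₁ ↦ L u) hf.mvfderiv
  have e3 := congrArg (fun L : E →L[ℝ] F₂ ↦ L u) hg.mvfderiv
  have e4 := congrArg (fun L : E →L[ℝ] F₃ ↦ L u) key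
  refine e1.trans (e4.trans ?_)
  rw [add_comm]
  refine congrArg₂ _ (congrArg₂ (fun a b ↦ B a b) e2.symm ?_)
    (congrArg₂ (fun a b ↦ B a b) ?_ e3.symm)
  all_goals exact congrArg _ (extChartAt_to_inv (I := I) x)

lemma mvfderiv_clm_apply {f : M → F₁ →L[ℝ] F₂} {g : M → F₁} {x : M}
    (hf : MDifferentiableAt I 𝓘(ℝ, F₁ →L[ℝ] F₂) f x) (hg : MDifferentiableAt I 𝓘(ℝ, F₁) g x)
    (u : TangentSpace I x) :
    mvfderiv I (fun y ↦ f y (g y)) x u = mvfderiv I f x u (g x) + f x (mvfderiv I g x u) :=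
  mvfderiv_bilin I (ContinuousLinearMap.id ℝ (F₁ →L[ℝ] F₂)) hf hg u

lemma mvfderiv_congr {f g : M → F₁} {x : M} (h : f =ᶠ[nhds x] g) :
    mvfderiv I f x = mvfderiv I g x := by
  unfold mvfderiv
  rw [h.mfderiv_eq, h.eq_of_nhds]

variable [IsManifold I ∞ M]

/-- The components of a vector field in the chart centred at `x`. -/
def chartVec (x : M) (Y : Π y : M, TangentSpace I y) (y : M) : E :=
  (trivializationAt E (TangentSpace I) x ⟨y, Y y⟩).2

/-- The tangent vectors at `y` with given components in the chart centred at `x`.  This inverts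
taking components only when `y` lies in the domain of that chart; elsewhere it is junk. -/
def chartFrame (x y : M) : E →L[ℝ] TangentSpace I y :=
  (trivializationAt E (TangentSpace I) x).symmL ℝ y

lemma diffAt_iff {x : M} {Y : Π y : M, TangentSpace I y} :
    DiffAt I Y x ↔ MDifferentiableAt I 𝓘(ℝ, E) (chartVec I x Y) x := by
  unfold DiffAt
  rw [mdifferentiableAt_totalSpace]
  exact ⟨fun h ↦ h.2, fun h ↦ ⟨mdifferentiableAt_id, h⟩⟩

lemma eventually_mem_chart (x : M) : ∀ᶠ y in nhds x, y ∈ (chartAt H x).source :=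
  (chartAt H x).open_source.mem_nhds (mem_chart_source H x)

lemma chartVec_eq {x y : M} (hy : y ∈ (chartAt H x).source) (Y : Π y : M, TangentSpace I y) :
    chartVec I x Y y = (trivializationAt E (TangentSpace I) x).continuousLinearMapAt ℝ y (Y y) := by
  rw [Trivialization.continuousLinearMapAt_apply, Trivialization.linearMapAt_apply,
    if_pos (by exact hy)]
  rfl

lemma chartVec_eq_mfderiv {x y : M} (hy : y ∈ (chartAt H x).source)
    (Y : Π y : M, TangentSpace I y) :
    chartVec I x Y y = mfderiv I 𝓘(ℝ, E) (extChartAt I x) y (Y y) := by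
  rw [chartVec_eq I hy, TangentBundle.continuousLinearMapAt_trivializationAt hy]
  rfl

lemma chartVec_self (x : M) (Y : Π y : M, TangentSpace I y) : chartVec I x Y x = Y x := by
  rw [chartVec_eq_mfderiv I (mem_chart_source H x), mfderiv_extChartAt_self]
  rfl

lemma chartFrame_chartVec {x y : M} (hy : y ∈ (chartAt H x).source)
    (Y : Π y : M, TangentSpace I y) : chartFrame I x y (chartVec I x Y y) = Y y := by
  rw [chartVec_eq I hy]
  exact Trivialization.symmL_continuousLinearMapAt _ hy _

lemma chartVec_chartFrame {x y : M} (hy : y ∈ (chartAt H x).source) (v : E) :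
    (trivializationAt E (TangentSpace I) x).continuousLinearMapAt ℝ y (chartFrame I x y v) = v :=
  Trivialization.continuousLinearMapAt_symmL _ hy _

lemma chartFrame_self (x : M) (v : E) : (chartFrame I x x v : E) = v := by
  have h2 := chartVec_self I x (fun y ↦ chartFrame I x y v)
  rw [chartVec_eq I (mem_chart_source H x), chartVec_chartFrame I (mem_chart_source H x)] at h2
  exact h2.symm

/-- The derivative at `x` of the components of `Y` in the chart centred at `x`.  It depends on that
chart: it is the covariant derivative at `x` for the flat connection of the chart. -/
def dVec (Y : Π y : M, TangentSpace I y) (x : M) : TangentSpace I x →L[ℝ] TangentSpace I x :=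
  mvfderiv I (chartVec I x Y) x

/-- In the chart centred at `x`, the Lie bracket is `[X, Y] = D_X Y - D_Y X` at `x`. -/
lemma mlieBracket_eq [CompleteSpace E] {X Y : Π y : M, TangentSpace I y} {x : M}
    (hX : DiffAt I X x) (hY : DiffAt I Y x) :
    mlieBracket I X Y x = dVec I Y x (X x) - dVec I X x (Y x) := by
  have key : ∀ Z : Π y : M, TangentSpace I y,
      (mpullbackWithin 𝓘(ℝ, E) I (extChartAt I x).symm Z (Set.range I) : E → E)
      =ᶠ[nhdsWithin (extChartAt I x x) (Set.range I)]
      (writtenInExtChartAt I 𝓘(ℝ, E) x (chartVec I x Z)) := by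
    intro Z
    filter_upwards [extChartAt_target_mem_nhdsWithin x] with z hz
    have hz' : (extChartAt I x).symm z ∈ (chartAt H x).source := by
      rw [← extChartAt_source I]; exact (extChartAt I x).map_target hz
    simp only [writtenInExtChartAt, Function.comp, extChartAt_model_space_eq_id,
      PartialEquiv.refl_coe, id]
    rw [chartVec_eq_mfderiv I hz', mpullbackWithin]
    let f : E →L[ℝ] TangentSpace I ((extChartAt I x).symm z) :=
      mfderivWithin 𝓘(ℝ, E) I (extChartAt I x).symm (Set.range I) z
    let f' : TangentSpace I ((extChartAt I x).symm z) →L[ℝ] E :=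
      mfderiv I 𝓘(ℝ, E) (extChartAt I x) ((extChartAt I x).symm z)
    have hinv : f.inverse = f' := ContinuousLinearMap.inverse_eq
      (mfderivWithin_extChartAt_symm_comp_mfderiv_extChartAt hz)
      (mfderiv_extChartAt_comp_mfderivWithin_extChartAt_symm hz)
    exact congrArg (fun L ↦ L (Z ((extChartAt I x).symm z))) hinv
  have hu : UniqueDiffWithinAt ℝ (Set.range I) (extChartAt I x x) :=
    I.uniqueDiffOn _ (Set.mem_range_self _)
  have hr : extChartAt I x x ∈ Set.range I := Set.mem_range_self _
  have e : ∀ Z : Π y : M, TangentSpace I y, DiffAt I Z x →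
      fderivWithin ℝ (mpullbackWithin 𝓘(ℝ, E) I (extChartAt I x).symm Z (Set.range I) : E → E)
        (Set.range I) (extChartAt I x x) = dVec I Z x := by
    intro Z hZ
    rw [(key Z).fderivWithin_eq_of_mem hr, dVec]
    exact ((diffAt_iff I).1 hZ).mvfderiv.symm
  have e0 : ∀ Z : Π y : M, TangentSpace I y,
      (mpullbackWithin 𝓘(ℝ, E) I (extChartAt I x).symm Z (Set.range I) : E → E)
        (extChartAt I x x) = Z x := by
    intro Z
    rw [(key Z).self_of_nhdsWithin hr]
    simp only [writtenInExtChartAt, Function.comp, extChartAt_model_space_eq_id,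
      PartialEquiv.refl_coe, id]
    rw [extChartAt_to_inv, chartVec_self]
  rw [mlieBracket, mlieBracketWithin_apply, mfderiv_extChartAt_self]
  simp only [Set.preimage_univ, Set.univ_inter, lieBracketWithin]
  have := congrArg₂ (fun a b : E ↦ a - b)
    (congrArg₂ (fun (L : E →L[ℝ] E) (v : E) ↦ L v) (e Y hY) (e0 X))
    (congrArg₂ (fun (L : E →L[ℝ] E) (v : E) ↦ L v) (e X hX) (e0 Y))
  exact (congrArg (fun L : E →L[ℝ] E ↦ L _) ContinuousLinearMap.inverse_id).trans this

/-- The vector field with constant components `v` in the chart centred at `x`. -/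
def constVec (x : M) (v : TangentSpace I x) (y : M) : TangentSpace I y := chartFrame I x y v

lemma constVec_self (x : M) (v : TangentSpace I x) : constVec I x v x = v := chartFrame_self I x v

lemma chartVec_constVec {x y : M} (hy : y ∈ (chartAt H x).source) (v : TangentSpace I x) :
    chartVec I x (constVec I x v) y = v := by
  rw [chartVec_eq I hy]
  exact chartVec_chartFrame I hy v

lemma chartVec_constVec_eventuallyEq (x : M) (v : TangentSpace I x) :
    chartVec I x (constVec I x v) =ᶠ[nhds x] fun _ ↦ (v : E) := by
  filter_upwards [eventually_mem_chart (H := H) x] with y hy using chartVec_constVec I hy v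

lemma diffAt_constVec (x : M) (v : TangentSpace I x) : DiffAt I (constVec I x v) x := by
  rw [diffAt_iff]
  exact (mdifferentiableAt_const (M' := E) (I' := 𝓘(ℝ, E)) (c := v)).congr_of_eventuallyEq
    (chartVec_constVec_eventuallyEq I x v)

lemma dVec_constVec (x : M) (v : TangentSpace I x) : dVec I (constVec I x v) x = 0 := by
  unfold dVec
  rw [mvfderiv_congr I (chartVec_constVec_eventuallyEq I x v)]
  exact mvfderiv_const _

/-- The components of an endomorphism field in the chart centred at `x`. -/
def chartEnd (Φ : Π y : M, TangentSpace I y →L[ℝ] TangentSpace I y) (x y : M) : E →L[ℝ] E :=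
  ((trivializationAt E (TangentSpace I) x).continuousLinearMapAt ℝ y).comp
    ((Φ y).comp (chartFrame I x y))

/-- The components of a 1-form in the chart centred at `x`. -/
def chartCovec (η : Π y : M, TangentSpace I y →L[ℝ] ℝ) (x y : M) : E →L[ℝ] ℝ :=
  (η y).comp (chartFrame I x y)

/-- The components of a bilinear form field in the chart centred at `x`. -/
def chartForm (h : Π y : M, TangentSpace I y →L[ℝ] TangentSpace I y →L[ℝ] ℝ) (x y : M) :
    E →L[ℝ] E →L[ℝ] ℝ :=
  ((chartFrame I x y).precomp ℝ).comp ((h y).comp (chartFrame I x y))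

/-- The derivative at `x` of the components of `Φ` in the chart centred at `x`; the first argument
is the direction of differentiation. -/
def dEnd (Φ : Π y : M, TangentSpace I y →L[ℝ] TangentSpace I y) (x : M) :
    TangentSpace I x →L[ℝ] TangentSpace I x →L[ℝ] TangentSpace I x :=
  mvfderiv I (chartEnd I Φ x) x

/-- The derivative at `x` of the components of `η` in the chart centred at `x`; the first argument
is the direction of differentiation. -/
def dCovec (η : Π y : M, TangentSpace I y →L[ℝ] ℝ) (x : M) :
    TangentSpace I x →L[ℝ] TangentSpace I x →L[ℝ] ℝ :=
  mvfderiv I (chartCovec I η x) x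

/-- The derivative at `x` of the components of `h` in the chart centred at `x`; the first argument
is the direction of differentiation. -/
def dForm (h : Π y : M, TangentSpace I y →L[ℝ] TangentSpace I y →L[ℝ] ℝ) (x : M) :
    TangentSpace I x →L[ℝ] TangentSpace I x →L[ℝ] TangentSpace I x →L[ℝ] ℝ :=
  mvfderiv I (chartForm I h x) x

/-- `Φ` is differentiable at `x`, in the chart centred at `x`. -/
def DiffEndAt (Φ : Π y : M, TangentSpace I y →L[ℝ] TangentSpace I y) (x : M) : Prop :=
  MDifferentiableAt I 𝓘(ℝ, E →L[ℝ] E) (chartEnd I Φ x) x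

/-- `η` is differentiable at `x`, in the chart centred at `x`. -/
def DiffCovecAt (η : Π y : M, TangentSpace I y →L[ℝ] ℝ) (x : M) : Prop :=
  MDifferentiableAt I 𝓘(ℝ, E →L[ℝ] ℝ) (chartCovec I η x) x

/-- `h` is differentiable at `x`, in the chart centred at `x`. -/
def DiffFormAt (h : Π y : M, TangentSpace I y →L[ℝ] TangentSpace I y →L[ℝ] ℝ) (x : M) : Prop :=
  MDifferentiableAt I 𝓘(ℝ, E →L[ℝ] E →L[ℝ] ℝ) (chartForm I h x) x

variable {I}
variable {Φ : Π y : M, TangentSpace I y →L[ℝ] TangentSpace I y}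
  {η : Π y : M, TangentSpace I y →L[ℝ] ℝ}
  {h : Π y : M, TangentSpace I y →L[ℝ] TangentSpace I y →L[ℝ] ℝ}
  {X Y Z : Π y : M, TangentSpace I y} {x : M}

lemma chartEnd_self (x : M) (v : TangentSpace I x) : (chartEnd I Φ x x v : E) = Φ x v := by
  have h1 := chartVec_self I x (fun y ↦ Φ y (chartFrame I x y v))
  rw [chartVec_eq I (mem_chart_source H x)] at h1
  refine h1.trans ?_
  exact congrArg (Φ x) (chartFrame_self I x v)

lemma chartCovec_self (x : M) (v : TangentSpace I x) : chartCovec I η x x v = η x v :=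
  congrArg (η x) (chartFrame_self I x v)

lemma chartForm_self (x : M) (v w : TangentSpace I x) : chartForm I h x x v w = h x v w :=
  congrArg₂ (fun a b ↦ h x a b) (chartFrame_self I x v) (chartFrame_self I x w)

lemma chartVec_apply_eventuallyEq (Φ : Π y : M, TangentSpace I y →L[ℝ] TangentSpace I y)
    (Y : Π y : M, TangentSpace I y) (x : M) :
    chartVec I x (fun y ↦ Φ y (Y y)) =ᶠ[nhds x] fun y ↦ chartEnd I Φ x y (chartVec I x Y y) := by
  filter_upwards [eventually_mem_chart (H := H) x] with y hy
  rw [chartVec_eq I hy]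
  exact congrArg (fun v ↦ (trivializationAt E (TangentSpace I) x).continuousLinearMapAt ℝ y (Φ y v))
    (chartFrame_chartVec I hy Y).symm

lemma covec_apply_eventuallyEq (η : Π y : M, TangentSpace I y →L[ℝ] ℝ)
    (Y : Π y : M, TangentSpace I y) (x : M) :
    (fun y ↦ η y (Y y)) =ᶠ[nhds x] fun y ↦ chartCovec I η x y (chartVec I x Y y) := by
  filter_upwards [eventually_mem_chart (H := H) x] with y hy
  exact congrArg (η y) (chartFrame_chartVec I hy Y).symm

lemma form_apply_eventuallyEq
    (h : Π y : M, TangentSpace I y →L[ℝ] TangentSpace I y →L[ℝ] ℝ)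
    (Y Z : Π y : M, TangentSpace I y) (x : M) :
    (fun y ↦ h y (Y y) (Z y)) =ᶠ[nhds x]
      fun y ↦ chartForm I h x y (chartVec I x Y y) (chartVec I x Z y) := by
  filter_upwards [eventually_mem_chart (H := H) x] with y hy
  exact congrArg₂ (fun a b ↦ h y a b) (chartFrame_chartVec I hy Y).symm
    (chartFrame_chartVec I hy Z).symm

lemma DiffEndAt.diffAt_apply (hΦ : DiffEndAt I Φ x) (hY : DiffAt I Y x) :
    DiffAt I (fun y ↦ Φ y (Y y)) x := by
  rw [diffAt_iff] at hY ⊢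
  exact (hΦ.clm_apply hY).congr_of_eventuallyEq (chartVec_apply_eventuallyEq Φ Y x)

lemma DiffEndAt.dVec_apply (hΦ : DiffEndAt I Φ x) (hY : DiffAt I Y x) (u : TangentSpace I x) :
    dVec I (fun y ↦ Φ y (Y y)) x u = dEnd I Φ x u (Y x) + Φ x (dVec I Y x u) := by
  have h1 := congrArg (fun L ↦ L u) (mvfderiv_congr I (chartVec_apply_eventuallyEq Φ Y x))
  refine h1.trans ((mvfderiv_clm_apply I hΦ ((diffAt_iff I).1 hY) u).trans ?_)
  refine congrArg₂ (fun a b : E ↦ a + b) ?_ ?_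
  · exact congrArg (fun v : E ↦ mvfderiv I (chartEnd I Φ x) x u v) (chartVec_self I x Y)
  · exact chartEnd_self x (dVec I Y x u)

lemma DiffCovecAt.mdifferentiableAt_apply (hη : DiffCovecAt I η x) (hY : DiffAt I Y x) :
    MDifferentiableAt I 𝓘(ℝ, ℝ) (fun y ↦ η y (Y y)) x := by
  rw [diffAt_iff] at hY
  exact (hη.clm_apply hY).congr_of_eventuallyEq (covec_apply_eventuallyEq η Y x)

lemma DiffCovecAt.mvfderiv_apply (hη : DiffCovecAt I η x) (hY : DiffAt I Y x)
    (u : TangentSpace I x) :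
    mvfderiv I (fun y ↦ η y (Y y)) x u = dCovec I η x u (Y x) + η x (dVec I Y x u) := by
  rw [mvfderiv_congr I (covec_apply_eventuallyEq η Y x)]
  refine (mvfderiv_clm_apply I hη ((diffAt_iff I).1 hY) u).trans ?_
  refine congrArg₂ (fun a b : ℝ ↦ a + b) ?_ ?_
  · exact congrArg (fun v : E ↦ mvfderiv I (chartCovec I η x) x u v) (chartVec_self I x Y)
  · exact chartCovec_self x (dVec I Y x u)

lemma DiffFormAt.mdifferentiableAt_apply (hh : DiffFormAt I h x) (hY : DiffAt I Y x)
    (hZ : DiffAt I Z x) : MDifferentiableAt I 𝓘(ℝ, ℝ) (fun y ↦ h y (Y y) (Z y)) x := by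
  rw [diffAt_iff] at hY hZ
  exact ((hh.clm_apply hY).clm_apply hZ).congr_of_eventuallyEq (form_apply_eventuallyEq h Y Z x)

lemma DiffFormAt.mvfderiv_apply (hh : DiffFormAt I h x) (hY : DiffAt I Y x)
    (hZ : DiffAt I Z x) (u : TangentSpace I x) :
    mvfderiv I (fun y ↦ h y (Y y) (Z y)) x u
      = dForm I h x u (Y x) (Z x) + h x (dVec I Y x u) (Z x) + h x (Y x) (dVec I Z x u) := by
  have hY' := (diffAt_iff I).1 hY
  have hZ' := (diffAt_iff I).1 hZ
  have h1 := mvfderiv_clm_apply I hh hY' u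
  rw [mvfderiv_congr I (form_apply_eventuallyEq h Y Z x),
    mvfderiv_clm_apply I (hh.clm_apply hY') hZ' u, h1]
  have e1 : mvfderiv I (chartForm I h x) x u (chartVec I x Y x) (chartVec I x Z x)
      = dForm I h x u (Y x) (Z x) :=
    congrArg₂ (fun a b : E ↦ mvfderiv I (chartForm I h x) x u a b) (chartVec_self I x Y)
      (chartVec_self I x Z)
  have e2 : chartForm I h x x (mvfderiv I (chartVec I x Y) x u) (chartVec I x Z x)
      = h x (dVec I Y x u) (Z x) :=
    (congrArg (fun b : E ↦ chartForm I h x x (dVec I Y x u) b) (chartVec_self I x Z)).trans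
      (chartForm_self x _ _)
  have e3 : chartForm I h x x (chartVec I x Y x) (mvfderiv I (chartVec I x Z) x u)
      = h x (Y x) (dVec I Z x u) :=
    (congrArg (fun b : E ↦ chartForm I h x x b (dVec I Z x u)) (chartVec_self I x Y)).trans
      (chartForm_self x _ _)
  rw [← e1, ← e2, ← e3]
  rfl

lemma chartVec_add {x y : M} (hy : y ∈ (chartAt H x).source) :
    chartVec I x (X + Y) y = chartVec I x X y + chartVec I x Y y := by
  simp only [chartVec_eq I hy, Pi.add_apply, map_add]

lemma chartVec_smul {x y : M} (hy : y ∈ (chartAt H x).source) (f : M → ℝ) :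
    chartVec I x (f • Y) y = f y • chartVec I x Y y := by
  simp only [chartVec_eq I hy, Pi.smul_apply', map_smul]

lemma dVec_add (hX : DiffAt I X x) (hY : DiffAt I Y x) :
    dVec I (X + Y) x = dVec I X x + dVec I Y x := by
  have h1 : chartVec I x (X + Y) =ᶠ[nhds x] chartVec I x X + chartVec I x Y := by
    filter_upwards [eventually_mem_chart (H := H) x] with y hy using chartVec_add hy
  unfold dVec
  rw [mvfderiv_congr I h1]
  exact mvfderiv_add ((diffAt_iff I).1 hX) ((diffAt_iff I).1 hY)

lemma dVec_smul {f : M → ℝ} (hf : MDifferentiableAt I 𝓘(ℝ, ℝ) f x) (hY : DiffAt I Y x)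
    (u : TangentSpace I x) :
    dVec I (f • Y) x u = f x • dVec I Y x u + mvfderiv I f x u • Y x := by
  have h1 : chartVec I x (f • Y) =ᶠ[nhds x] f • chartVec I x Y := by
    filter_upwards [eventually_mem_chart (H := H) x] with y hy using chartVec_smul hy f
  unfold dVec
  rw [mvfderiv_congr I h1]
  have h2 := congrArg (fun L ↦ L u) (mvfderiv_smul hf ((diffAt_iff I).1 hY))
  refine h2.trans ?_
  refine congrArg (fun a : E ↦ f x • mvfderiv I (chartVec I x Y) x u + mvfderiv I f x u • a) ?_
  exact chartVec_self I x Y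

end Coordinates

/-! ### Brackets, exterior derivatives and smoothness in coordinates -/

section PointwiseFormulas
variable {E : Type*} [NormedAddCommGroup E] [NormedSpace ℝ E]
  {H : Type*} [TopologicalSpace H] {I : ModelWithCorners ℝ E H}
  {M : Type*} [TopologicalSpace M] [ChartedSpace H M] [IsManifold I ∞ M]
variable {Φ : Π y : M, TangentSpace I y →L[ℝ] TangentSpace I y}
  {η : Π y : M, TangentSpace I y →L[ℝ] ℝ}
  {h : Π y : M, TangentSpace I y →L[ℝ] TangentSpace I y →L[ℝ] ℝ}
  {X Y Z : Π y : M, TangentSpace I y} {x : M}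

lemma nijenhuis_eq [CompleteSpace E] (hΦ : DiffEndAt I Φ x) (hX : DiffAt I X x)
    (hY : DiffAt I Y x) :
    nijenhuis I Φ X Y x = dEnd I Φ x (Φ x (X x)) (Y x) - dEnd I Φ x (Φ x (Y x)) (X x)
      - Φ x (dEnd I Φ x (X x) (Y x)) + Φ x (dEnd I Φ x (Y x) (X x)) := by
  have hX' := hΦ.diffAt_apply hX
  have hY' := hΦ.diffAt_apply hY
  unfold nijenhuis
  rw [mlieBracket_eq I hX' hY', mlieBracket_eq I hX hY, mlieBracket_eq I hX hY',
    mlieBracket_eq I hX' hY]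
  simp only [hΦ.dVec_apply hX, hΦ.dVec_apply hY, map_add, map_sub]
  abel

lemma extDerivOne_eq [CompleteSpace E] (hη : DiffCovecAt I η x) (hX : DiffAt I X x)
    (hY : DiffAt I Y x) :
    extDerivOne I η X Y x = dCovec I η x (X x) (Y x) - dCovec I η x (Y x) (X x) := by
  unfold extDerivOne
  rw [mlieBracket_eq I hX hY, hη.mvfderiv_apply hX, hη.mvfderiv_apply hY, map_sub]
  ring

lemma extDerivTwo_eq [CompleteSpace E] (hh : DiffFormAt I h x)
    (hskew : ∀ v w, h x v w = -h x w v) (hX : DiffAt I X x)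
    (hY : DiffAt I Y x) (hZ : DiffAt I Z x) :
    extDerivTwo I h X Y Z x = dForm I h x (X x) (Y x) (Z x) - dForm I h x (Y x) (X x) (Z x)
      + dForm I h x (Z x) (X x) (Y x) := by
  unfold extDerivTwo
  rw [mlieBracket_eq I hX hY, mlieBracket_eq I hX hZ, mlieBracket_eq I hY hZ,
    hh.mvfderiv_apply hX hY, hh.mvfderiv_apply hX hZ, hh.mvfderiv_apply hY hZ]
  simp only [map_sub, sub_apply]
  rw [hskew (Y x) (dVec I Z x (X x)), hskew (X x) (dVec I Z x (Y x)),
    hskew (X x) (dVec I Y x (Z x))]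
  ring

lemma smoothEndo_iff :
    SmoothEndo I Φ ↔ ∀ x, ContMDiffAt I 𝓘(ℝ, E →L[ℝ] E) ∞ (chartEnd I Φ x) x := by
  refine forall_congr' fun x ↦ ?_
  rw [contMDiffAt_hom_bundle]
  exact ⟨fun h ↦ h.2, fun h ↦ ⟨contMDiffAt_id, h⟩⟩

lemma smoothCovec_iff :
    ContMDiff I (I.prod 𝓘(ℝ, E →L[ℝ] ℝ)) ∞
    (fun y ↦ TotalSpace.mk' (E →L[ℝ] ℝ) (E := fun y : M ↦ TangentSpace I y →L[ℝ] ℝ) y (η y))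
      ↔ ∀ x, ContMDiffAt I 𝓘(ℝ, E →L[ℝ] ℝ) ∞ (chartCovec I η x) x := by
  refine forall_congr' fun x ↦ ?_
  have := contMDiffAt_hom_bundle (E₂ := Bundle.Trivial M ℝ) (F₂ := ℝ) (n := ∞) (IM := I) (IB := I)
    (fun y ↦ (TotalSpace.mk' (E →L[ℝ] ℝ)
      (E := fun y : M ↦ TangentSpace I y →L[ℝ] Bundle.Trivial M ℝ y) y (η y)))
    (x₀ := x)
  refine this.trans ?_
  have e : (fun y ↦ ContinuousLinearMap.inCoordinates E (TangentSpace I) ℝ (Bundle.Trivial M ℝ)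
      x y x y (η y)) = chartCovec I η x := by
    ext y v
    simp [ContinuousLinearMap.inCoordinates, chartCovec, chartFrame]
  rw [← e]
  exact ⟨fun h ↦ h.2, fun h ↦ ⟨contMDiffAt_id, h⟩⟩

lemma smoothVec_iff {ξ : Π y : M, TangentSpace I y} :
    ContMDiff I I.tangent ∞ (fun y ↦ (⟨y, ξ y⟩ : TangentBundle I M))
      ↔ ∀ x, ContMDiffAt I 𝓘(ℝ, E) ∞ (chartVec I x ξ) x := by
  refine forall_congr' fun x ↦ ?_
  rw [contMDiffAt_totalSpace]
  exact ⟨fun h ↦ h.2, fun h ↦ ⟨contMDiffAt_id, h⟩⟩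

lemma smoothMetric (g : ContMDiffRiemannianMetric I ∞ E (fun y : M ↦ TangentSpace I y)) (x : M) :
   ContMDiffAt I 𝓘(ℝ, E →L[ℝ] E →L[ℝ] ℝ) ∞ (chartForm I g.inner x) x := by
  have h1 := g.contMDiff x
  have := (contMDiffAt_hom_bundle (E₂ := fun y : M ↦ (TangentSpace I y →L[ℝ] ℝ)) (F₂ := E →L[ℝ] ℝ)
    (n := ∞) (IM := I) (IB := I) _ ).1 h1
  refine this.2.congr_of_eventuallyEq ?_
  filter_upwards [eventually_mem_chart (H := H) x] with y hy
  ext v w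
  refine Eq.trans ?_ (inCoordinates_apply_eq₂ (E₁ := fun y : M ↦ TangentSpace I y)
    (E₂ := fun y : M ↦ TangentSpace I y) (E₃ := Bundle.Trivial M ℝ) (F₃ := ℝ)
    hy hy (Set.mem_univ _)).symm
  simp [chartForm, chartFrame]
  rw [Trivialization.symmL_apply, Trivialization.symmL_apply] <;> exact hy

end PointwiseFormulas

/-! ### The Bismut connection -/

section Bismut

lemma exists_form_eq {V : Type*} [AddCommGroup V] [Module ℝ V] [TopologicalSpace V]
    [IsTopologicalAddGroup V] [ContinuousSMul ℝ V] [FiniteDimensional ℝ V]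
    (h : V →L[ℝ] V →L[ℝ] ℝ) (hnd : ∀ v, (∀ w, h v w = 0) → v = 0) (f : V →ₗ[ℝ] ℝ) :
    ∃ v, ∀ w, h v w = f w := by
  let F : V →ₗ[ℝ] Module.Dual ℝ V := h.toBilinForm
  have hinj : Function.Injective F := by
    rw [injective_iff_map_eq_zero]
    exact fun v hv ↦ hnd v fun w ↦ LinearMap.congr_fun hv w
  obtain ⟨v, hv⟩ := (LinearMap.injective_iff_surjective_of_finrank_eq_finrank
    Subspace.dual_finrank_eq.symm).1 hinj f
  exact ⟨v, fun w ↦ LinearMap.congr_fun hv w⟩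

section Multilinear

variable {V : Type*} [AddCommGroup V] [Module ℝ V] [TopologicalSpace V]

lemma form_add_left (h : V →L[ℝ] V →L[ℝ] ℝ) (u u' v : V) : h (u + u') v = h u v + h u' v := by
  rw [map_add, add_apply]

lemma form_sub_left (h : V →L[ℝ] V →L[ℝ] ℝ) (u u' v : V) : h (u - u') v = h u v - h u' v := by
  rw [map_sub, sub_apply]

lemma form_smul_left (h : V →L[ℝ] V →L[ℝ] ℝ) (c : ℝ) (u v : V) : h (c • u) v = c * h u v := by
  rw [map_smul, smul_apply, smul_eq_mul]

lemma form_neg_left (h : V →L[ℝ] V →L[ℝ] ℝ) (u v : V) : h (-u) v = -h u v := by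
  rw [map_neg, neg_apply]

lemma form_zero_left (h : V →L[ℝ] V →L[ℝ] ℝ) (v : V) : h 0 v = 0 := by
  rw [map_zero, zero_apply]

variable (T : V →L[ℝ] V →L[ℝ] V →L[ℝ] ℝ)

lemma tri_add₁ (u u' v w : V) : T (u + u') v w = T u v w + T u' v w := by
  rw [T.map_add, add_apply, add_apply]

lemma tri_add₂ (u v v' w : V) : T u (v + v') w = T u v w + T u v' w := by
  rw [map_add, add_apply]

lemma tri_add₃ (u v w w' : V) : T u v (w + w') = T u v w + T u v w' := map_add _ _ _

lemma tri_smul₁ (c : ℝ) (u v w : V) : T (c • u) v w = c * T u v w := by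
  rw [T.map_smul, smul_apply, smul_apply, smul_eq_mul]

lemma tri_smul₂ (c : ℝ) (u v w : V) : T u (c • v) w = c * T u v w := by
  rw [map_smul, smul_apply, smul_eq_mul]

lemma tri_smul₃ (c : ℝ) (u v w : V) : T u v (c • w) = c * T u v w := by
  rw [map_smul, smul_eq_mul]

lemma tri_zero₁ (v w : V) : T 0 v w = 0 := by
  rw [T.map_zero, zero_apply, zero_apply]

lemma tri_zero₂ (u w : V) : T u 0 w = 0 := by
  rw [map_zero, zero_apply]

lemma tri_neg₁ (u v w : V) : T (-u) v w = - T u v w := by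
  rw [← neg_one_smul ℝ u, tri_smul₁]; ring

lemma tri_neg₂ (u v w : V) : T u (-v) w = - T u v w := by
  rw [map_neg, neg_apply]

lemma tri_neg₃ (u v w : V) : T u v (-w) = - T u v w := map_neg _ _

lemma bilin_neg_left [IsTopologicalAddGroup V] [ContinuousSMul ℝ V] (S : V →L[ℝ] V →L[ℝ] V)
    (u v : V) : S (-u) v = - S u v := by
  rw [← neg_one_smul ℝ u, map_smul, smul_apply, neg_one_smul]

end Multilinear

variable {E : Type*} [NormedAddCommGroup E] [NormedSpace ℝ E]
  {H : Type*} [TopologicalSpace H] {I : ModelWithCorners ℝ E H}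
  {M : Type*} [TopologicalSpace M] [ChartedSpace H M] [IsManifold I ∞ M]
variable {J : Π y : M, TangentSpace I y →L[ℝ] TangentSpace I y}
  {h : Π y : M, TangentSpace I y →L[ℝ] TangentSpace I y →L[ℝ] ℝ}
  {B : Π y : M, TangentSpace I y →L[ℝ] TangentSpace I y →L[ℝ] TangentSpace I y →L[ℝ] ℝ}
  {x : M}

/-- In coordinates, `2 h((∇_u J) v, w)` for the Levi-Civita connection `∇` of `h`. -/
def lcDerivEnd (h : Π y : M, TangentSpace I y →L[ℝ] TangentSpace I y →L[ℝ] ℝ)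
    (J : Π y : M, TangentSpace I y →L[ℝ] TangentSpace I y) (x : M) (u v w : TangentSpace I x) : ℝ :=
  2 * h x (dEnd I J x u v) w + dForm I h x u (J x v) w + dForm I h x u v (J x w)
    + dForm I h x (J x v) u w - dForm I h x w u (J x v) + dForm I h x v u (J x w)
    - dForm I h x (J x w) u v

lemma mvfderiv_form_constVec (hh : DiffFormAt I h x) (u a b : TangentSpace I x) :
    mvfderiv I (fun y ↦ h y (constVec I x a y) (constVec I x b y)) x u = dForm I h x u a b := by
  rw [hh.mvfderiv_apply (diffAt_constVec I x a) (diffAt_constVec I x b)]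
  simp [dVec_constVec, constVec_self]

lemma dForm_symm (hh : DiffFormAt I h x) (hs : ∀ y v w, h y v w = h y w v)
    (u v w : TangentSpace I x) : dForm I h x u v w = dForm I h x u w v := by
  rw [← mvfderiv_form_constVec hh, ← mvfderiv_form_constVec hh]
  congr 1
  exact mvfderiv_congr I (Filter.Eventually.of_forall fun y ↦ hs _ _ _)

lemma dForm_skew (hh : DiffFormAt I h x) (hs : ∀ y v w, h y v w = -h y w v)
    (u v w : TangentSpace I x) : dForm I h x u v w = -dForm I h x u w v := by
  have e := mvfderiv_congr I (x := x) (Filter.Eventually.of_forall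
    fun y ↦ hs y (constVec I x v y) (constVec I x w y))
  rw [mvfderiv_fun_neg] at e
  have e' : mvfderiv I (fun y ↦ h y (constVec I x v y) (constVec I x w y)) x u
      = -(mvfderiv I (fun y ↦ h y (constVec I x w y) (constVec I x v y)) x u) :=
    congrArg (fun L ↦ L u) e
  rwa [mvfderiv_form_constVec hh, mvfderiv_form_constVec hh] at e'

lemma DiffFormAt.fundamentalForm (hh : DiffFormAt I h x) (hJ : DiffEndAt I J x) :
    DiffFormAt I (fundamentalForm I h J) x := by
  refine (hh.clm_comp hJ).congr_of_eventuallyEq ?_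
  filter_upwards [eventually_mem_chart (H := H) x] with y hy
  ext v w
  exact congrArg (fun a ↦ h y a (chartFrame I x y w))
    (Trivialization.symmL_continuousLinearMapAt _ hy (J y (chartFrame I x y v))).symm

lemma dForm_fundamentalForm (hh : DiffFormAt I h x) (hJ : DiffEndAt I J x)
    (u v w : TangentSpace I x) :
    dForm I (STGeom.fundamentalForm I h J) x u v w
      = dForm I h x u (J x v) w + h x (dEnd I J x u v) w := by
  have hV := diffAt_constVec I x v
  have hW := diffAt_constVec I x w
  rw [← mvfderiv_form_constVec (hh.fundamentalForm hJ)]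
  refine (hh.mvfderiv_apply (hJ.diffAt_apply hV) hW u).trans ?_
  rw [hJ.dVec_apply hV]
  simp [dVec_constVec, constVec_self]

lemma dEnd_sq_neg (hJ : DiffEndAt I J x) (hsq : ∀ y v, J y (J y v) = -v)
    (u v : TangentSpace I x) : dEnd I J x u (J x v) = -J x (dEnd I J x u v) := by
  have hV := diffAt_constVec I x v
  have e : (fun y ↦ J y (J y (constVec I x v y))) = (fun _ : M ↦ (-1 : ℝ)) • constVec I x v := by
    funext y
    rw [hsq]
    simp
  have e1 := hJ.dVec_apply (hJ.diffAt_apply hV) u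
  rw [e, dVec_smul mdifferentiableAt_const hV, hJ.dVec_apply hV] at e1
  simp only [dVec_constVec, constVec_self, zero_apply, smul_zero, mvfderiv_const, zero_smul,
    map_zero, add_zero] at e1
  exact eq_neg_of_add_eq_zero_left e1.symm

variable [FiniteDimensional ℝ E]

/-- Koszul's formula for a metric connection with totally skew torsion `B`, in the chart centred at
`x`: the Levi-Civita terms, plus `B / 2`. -/
lemma koszul (hh : DiffFormAt I h x) (hs : ∀ y v w, h y v w = h y w v)
    (hB : TotallySkew I B)
    (cov : CovariantDerivative I E (fun y : M ↦ TangentSpace I y))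
    (hmet : ∀ (Y Z : Π y : M, TangentSpace I y), DiffAt I Y x → DiffAt I Z x →
      ∀ u : TangentSpace I x,
        mvfderiv I (fun y ↦ h y (Y y) (Z y)) x u
          = h x (cov Y x u) (Z x) + h x (Y x) (cov Z x u))
    (htor : ∀ (u v w : TangentSpace I x), h x (cov.torsion x u v) w = B x u v w)
    {Y : Π y : M, TangentSpace I y} (hY : DiffAt I Y x) (u w : TangentSpace I x) :
    2 * h x (cov Y x u) w = 2 * h x (dVec I Y x u) w + dForm I h x u (Y x) w
      + dForm I h x (Y x) u w - dForm I h x w u (Y x) + B x u (Y x) w := by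
  have hU := diffAt_constVec I x u
  have hW := diffAt_constVec I x w
  have c1 := hmet _ _ hY hW u
  have c2 := hmet _ _ hU hW (Y x)
  have c3 := hmet _ _ hU hY w
  rw [hh.mvfderiv_apply hY hW] at c1
  rw [hh.mvfderiv_apply hU hW] at c2
  rw [hh.mvfderiv_apply hU hY] at c3
  have ht : ∀ {X Z : Π y : M, TangentSpace I y}, DiffAt I X x → DiffAt I Z x →
      ∀ v, h x (cov Z x (X x)) v - h x (cov X x (Z x)) v
        - (h x (dVec I Z x (X x)) v - h x (dVec I X x (Z x)) v) = B x (X x) (Z x) v := by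
    intro X Z hX hZ v
    rw [← htor, cov.torsion_apply hX hZ, mlieBracket_eq I hX hZ]
    simp
  have t1 := ht hU hY w
  have t2 := ht hU hW (Y x)
  have t3 := ht hY hW u
  simp only [constVec_self, dVec_constVec, zero_apply, map_zero] at c1 c2 c3 t1 t2 t3
  have b1 := hB.2 x u w (Y x)
  have b2 := hB.1 x (Y x) w u
  have b3 := hB.2 x w (Y x) u
  have b4 := hB.1 x w u (Y x)
  have s1 := hs x (Y x) (cov (constVec I x w) x u)
  have s2 := hs x u (cov (constVec I x w) x (Y x))
  have s3 := hs x u (cov Y x w)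
  have s4 := hs x u (dVec I Y x w)
  linarith

/-- A metric connection with totally skew torsion `B` is determined by `B` through Koszul's formula,
so the existence of a Bismut connection is the single tensor equation `∇J = 0`, rewritten here as
an equation between `B` and the Levi-Civita derivative of `J`. -/
theorem isBismutTorsion_iff (hh : ∀ x, DiffFormAt I h x) (hs : ∀ y v w, h y v w = h y w v)
    (hnd : ∀ y v, (∀ w, h y v w = 0) → v = 0) (hJ : ∀ x, DiffEndAt I J x)
    (hsk : ∀ y v w, h y (J y v) w = - h y v (J y w)) :
    IsBismutTorsion I h J B ↔ TotallySkew I B ∧ ∀ x u v w,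
      lcDerivEnd h J x u v w = - B x u (J x v) w - B x u v (J x w) := by
  constructor
  · rintro ⟨hB, cov, hmet, hpar, htor⟩
    refine ⟨hB, fun x u v w ↦ ?_⟩
    have hV := diffAt_constVec I x v
    have hJV := (hJ x).diffAt_apply hV
    have k1 := koszul (hh x) hs hB cov (hmet x) (htor x) hJV u w
    have k2 := koszul (hh x) hs hB cov (hmet x) (htor x) hV u (J x w)
    rw [hpar x _ hV u, hsk, (hJ x).dVec_apply hV] at k1
    simp only [constVec_self, dVec_constVec, zero_apply, map_zero, add_zero] at k1 k2
    unfold lcDerivEnd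
    linarith
  · rintro ⟨hB, hA⟩
    refine ⟨hB, ?_⟩
    -- The Christoffel symbols that Koszul's formula prescribes.
    have ex : ∀ x (u v : TangentSpace I x), ∃ k : TangentSpace I x, ∀ w,
        h x k w = (1 / 2) * (dForm I h x u v w + dForm I h x v u w - dForm I h x w u v
          + B x u v w) := by
      intro x u v
      have : FiniteDimensional ℝ (TangentSpace I x) := inferInstanceAs (FiniteDimensional ℝ E)
      exact exists_form_eq (h x) (hnd x)
        { toFun := fun w ↦ (1 / 2) * (dForm I h x u v w + dForm I h x v u w - dForm I h x w u v
            + B x u v w)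
          map_add' := fun a b ↦ by simp only [tri_add₁, tri_add₃]; ring
          map_smul' := fun c a ↦ by
            simp only [tri_smul₁, tri_smul₃, RingHom.id_apply, smul_eq_mul]; ring }
    choose Γ hΓ using ex
    have uniq : ∀ x (a b : TangentSpace I x), (∀ w, h x a w = h x b w) → a = b := by
      intro x a b hab
      rw [← sub_eq_zero]
      exact hnd x _ fun w ↦ by rw [map_sub, sub_apply, hab, sub_self]
    have Γ_add_left : ∀ x (u u' v : TangentSpace I x), Γ x (u + u') v = Γ x u v + Γ x u' v :=
      fun x u u' v ↦ uniq x _ _ fun w ↦ by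
        simp only [form_add_left, tri_add₁, hΓ]; ring
    have Γ_smul_left : ∀ x (c : ℝ) (u v : TangentSpace I x), Γ x (c • u) v = c • Γ x u v :=
      fun x c u v ↦ uniq x _ _ fun w ↦ by
        simp only [form_smul_left, tri_smul₁, hΓ]; ring
    have Γ_add_right : ∀ x (u v v' : TangentSpace I x), Γ x u (v + v') = Γ x u v + Γ x u v' :=
      fun x u v v' ↦ uniq x _ _ fun w ↦ by
        simp only [form_add_left, tri_add₁, tri_add₃, hΓ]; ring
    have Γ_smul_right : ∀ x (c : ℝ) (u v : TangentSpace I x), Γ x u (c • v) = c • Γ x u v :=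
      fun x c u v ↦ uniq x _ _ fun w ↦ by
        simp only [form_smul_left, tri_smul₁, tri_smul₃, hΓ]; ring
    let G : ∀ x, TangentSpace I x → TangentSpace I x →L[ℝ] TangentSpace I x := fun x v ↦
      have : FiniteDimensional ℝ (TangentSpace I x) := inferInstanceAs (FiniteDimensional ℝ E)
      have : T2Space (TangentSpace I x) := inferInstanceAs (T2Space E)
      LinearMap.toContinuousLinearMap
        { toFun := fun u ↦ Γ x u v
          map_add' := fun u u' ↦ Γ_add_left x u u' v
          map_smul' := fun c u ↦ Γ_smul_left x c u v }
    have hG : ∀ x u v, G x v u = Γ x u v := fun _ _ _ ↦ rfl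
    let cov : CovariantDerivative I E (fun y : M ↦ TangentSpace I y) :=
      { toFun := fun Y x ↦ dVec I Y x + G x (Y x)
        isCovariantDerivativeOnUniv :=
          { add := fun {X Y x} hX hY _ ↦ by
              ext u
              have := congrArg (fun L ↦ L u) (dVec_add (I := I) hX hY)
              simp only [add_apply] at this
              simp only [add_apply, this, hG, Pi.add_apply, Γ_add_right]
              abel
            leibniz := fun {Y f x} hY hf _ ↦ by
              ext u
              have := dVec_smul (I := I) hf hY u
              simp only [add_apply, this, hG, Pi.smul_apply', Γ_smul_right, smul_apply, smul_add,
                ContinuousLinearMap.smulRight_apply]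
              abel } }
    have hcov : ∀ Y x u, cov Y x u = dVec I Y x u + Γ x u (Y x) := fun _ _ _ ↦ rfl
    refine ⟨cov, fun x Y Z hY hZ u ↦ ?_, fun x Y hY u ↦ uniq x _ _ fun w ↦ ?_, fun x u v w ↦ ?_⟩
    · rw [(hh x).mvfderiv_apply hY hZ, hcov, hcov, form_add_left, map_add,
        hs x (Y x) (Γ x u (Z x)), hΓ, hΓ, dForm_symm (hh x) hs u (Z x) (Y x), hB.2 x u (Z x) (Y x)]
      ring
    · rw [hcov, (hJ x).dVec_apply hY, hsk, hcov]
      simp only [form_add_left, hΓ, hsk]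
      have := hA x u (Y x) w
      unfold lcDerivEnd at this
      linarith
    · have hU := diffAt_constVec I x u
      have hV := diffAt_constVec I x v
      have := cov.torsion_apply hU hV
      rw [mlieBracket_eq I hU hV, hcov, hcov] at this
      simp only [constVec_self, dVec_constVec, zero_apply, zero_add, sub_zero] at this
      rw [this, form_sub_left, hΓ, hΓ, dForm_symm (hh x) hs w u v, hB.1 x v u w]
      ring
end Bismut

/-! ### Kähler-with-torsion structures as tensor equations -/

section KTAlgebra

/-- The algebra behind the formula for the Bismut torsion.  In the application `A(u, v, w)` is
`2 g((∇_u J) v, w)` for the Levi-Civita connection `∇`, `D` is the exterior derivative of the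
fundamental form, and `hN` says that the Nijenhuis tensor of `J` vanishes. -/
lemma parallel_iff_torsion_eq {V : Type*} {J : V → V} {A B D : V → V → V → ℝ}
    (hB₁ : ∀ u v w, B u v w = -B v u w) (hB₂ : ∀ u v w, B u v w = -B u w v)
    (hBJ : ∀ u v w, B u v (J (J w)) = -B u v w)
    (hA : ∀ u v w, A u v w = -A u w v) (hAJ : ∀ u v w, A u (J v) w = A u v (J w))
    (hA₁ : ∀ u v w, A (J (J u)) v w = -A u v w) (hA₃ : ∀ u v w, A u v (J (J w)) = -A u v w)
    (hN : ∀ u v w, A (J u) v w - A (J v) u w + A u v (J w) - A v u (J w) = 0)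
    (hD : ∀ u v w, 2 * D u v w = A u v w + A v w u + A w u v) :
    (∀ u v w, A u v w = -B u (J v) w - B u v (J w)) ↔
      ∀ u v w, B u v w = D (J u) (J v) (J w) := by
  have hBJ₂ : ∀ u v w, B u (J (J v)) w = -B u v w := fun u v w ↦ by
    rw [hB₂, hBJ, hB₂ u v w]
  constructor
  · intro hK u v w
    have n := hN u v w
    have d := hD (J u) (J v) (J w)
    simp only [hK, hBJ, hBJ₂] at n d
    linarith [hB₁ v u w, hB₁ (J v) (J u) w, hB₁ (J v) u (J w), hB₁ v (J u) (J w),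
      hB₂ (J u) (J w) v, hB₁ (J w) (J u) v, hB₂ (J v) (J w) u, hB₁ (J w) (J v) u,
      hB₂ (J v) u (J w), hB₁ (J v) u (J w), hB₁ (J w) u (J v), hB₂ u (J w) (J v),
      hB₂ (J w) u (J v), hB₂ (J v) w (J u)]
  · intro h u v w
    have d₁ := hD (J u) (J (J v)) (J w)
    have d₂ := hD (J u) (J v) (J (J w))
    have n₁ := hN u v (J w)
    have n₂ := hN u w (J v)
    simp only [hAJ, hA₁, hA₃] at d₁ d₂ n₁ n₂
    rw [h, h]
    linarith [hA (J u) w (J v), hAJ (J u) v w, hA (J v) w (J u), hAJ (J v) u w, hA v u w,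
      hA u w v]

variable {E : Type*} [NormedAddCommGroup E] [NormedSpace ℝ E]
  {H : Type*} [TopologicalSpace H] {I : ModelWithCorners ℝ E H}
  {M : Type*} [TopologicalSpace M] [ChartedSpace H M] [IsManifold I ∞ M]
variable {J : Π y : M, TangentSpace I y →L[ℝ] TangentSpace I y}
  {h : Π y : M, TangentSpace I y →L[ℝ] TangentSpace I y →L[ℝ] ℝ}
  {B : Π y : M, TangentSpace I y →L[ℝ] TangentSpace I y →L[ℝ] TangentSpace I y →L[ℝ] ℝ}
  {x : M}

/-- The exterior derivative of a 2-form as a tensor, in the chart centred at `x`. -/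
def dTwo (β : Π y : M, TangentSpace I y →L[ℝ] TangentSpace I y →L[ℝ] ℝ) (x : M)
    (u v w : TangentSpace I x) : ℝ :=
  dForm I β x u v w - dForm I β x v u w + dForm I β x w u v

/-- The Nijenhuis tensor of `Φ` as a tensor, in the chart centred at `x`. -/
def nijenhuisAt (Φ : Π y : M, TangentSpace I y →L[ℝ] TangentSpace I y) (x : M)
    (u v : TangentSpace I x) : TangentSpace I x :=
  dEnd I Φ x (Φ x u) v - dEnd I Φ x (Φ x v) u - Φ x (dEnd I Φ x u v) + Φ x (dEnd I Φ x v u)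

/-- The vanishing of the Nijenhuis tensor in terms of the Levi-Civita derivative of `J`. -/
lemma lcDerivEnd_nijenhuis (hh : DiffFormAt I h x) (hs : ∀ y v w, h y v w = h y w v)
    (hsq : ∀ y v, J y (J y v) = -v) (hsk : ∀ y v w, h y (J y v) w = - h y v (J y w))
    (hN : ∀ u v, nijenhuisAt J x u v = 0) (u v w : TangentSpace I x) :
    lcDerivEnd h J x (J x u) v w - lcDerivEnd h J x (J x v) u w + lcDerivEnd h J x u v (J x w)
      - lcDerivEnd h J x v u (J x w) = 0 := by
  have dsy := dForm_symm hh hs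
  have n : h x (nijenhuisAt J x u v) w = 0 := by rw [hN, map_zero, zero_apply]
  unfold nijenhuisAt at n
  simp only [form_add_left, form_sub_left, hsk] at n
  unfold lcDerivEnd
  simp only [hsq, tri_neg₁, tri_neg₃]
  linarith [dsy (J x v) u (J x w), dsy (J x u) v (J x w), dsy (J x u) (J x v) w,
    dsy (J x v) (J x u) w, dsy w (J x u) (J x v), dsy w u v, dsy u v w, dsy v u w,
    dsy (J x w) u (J x v), dsy (J x w) (J x u) v]

theorem lcDerivEnd_eq_iff (hh : DiffFormAt I h x) (hs : ∀ y v w, h y v w = h y w v)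
    (hJ : DiffEndAt I J x) (hsq : ∀ y v, J y (J y v) = -v)
    (hsk : ∀ y v w, h y (J y v) w = - h y v (J y w))
    (hN : ∀ u v, nijenhuisAt J x u v = 0) (hB : TotallySkew I B) :
    (∀ u v w, lcDerivEnd h J x u v w = - B x u (J x v) w - B x u v (J x w)) ↔
    ∀ u v w, B x u v w = dTwo (STGeom.fundamentalForm I h J) x (J x u) (J x v) (J x w) := by
  have fsk : ∀ y v w, STGeom.fundamentalForm I h J y v w =
      -STGeom.fundamentalForm I h J y w v := by
    intro y v w
    change h y (J y v) w = - h y (J y w) v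
    rw [hsk, hs]
  have dsq := dEnd_sq_neg hJ hsq
  have dsk := dForm_skew (hh.fundamentalForm hJ) fsk
  simp only [dForm_fundamentalForm hh hJ] at dsk
  have dsy := dForm_symm hh hs
  have dsq' : ∀ u v w, h x (dEnd I J x u (J x v)) w = h x (dEnd I J x u v) (J x w) := by
    intro u v w
    rw [dsq, form_neg_left, hsk, neg_neg]
  apply parallel_iff_torsion_eq (hB.1 x) (hB.2 x)
  · intro u v w
    rw [hsq, tri_neg₃]
  · intro u v w
    unfold lcDerivEnd
    linarith [dsk u v w, dsy u (J x v) w, dsy u v (J x w), dsy (J x v) u w, dsy w u (J x v),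
      dsy v u (J x w), dsy (J x w) u v]
  · intro u v w
    unfold lcDerivEnd
    simp only [hsq, dsq', tri_neg₁, tri_neg₂, tri_neg₃]
    ring
  · intro u v w
    unfold lcDerivEnd
    simp only [hsq, bilin_neg_left, form_neg_left, tri_neg₁]
    ring
  · intro u v w
    unfold lcDerivEnd
    simp only [hsq, map_neg (h x _), map_neg (J x), tri_neg₁, tri_neg₃]
    ring
  · exact lcDerivEnd_nijenhuis hh hs hsq hsk hN
  · intro u v w
    unfold dTwo lcDerivEnd
    simp only [dForm_fundamentalForm hh hJ]
    linarith [dsk u v w, dsk v u w, dsk v w u, dsk w u v, dsy u (J x v) w, dsy u v (J x w),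
      dsy (J x v) u w, dsy w u (J x v), dsy v u (J x w), dsy (J x w) u v, dsy v (J x w) u,
      dsy v w (J x u), dsy (J x w) v u, dsy w v (J x u), dsy (J x u) v w, dsy w (J x u) v,
      dsy (J x u) w v, dsy u w (J x v), dsy (J x v) w u]

lemma nijenhuis_eq_zero_iff [CompleteSpace E] (hJ : DiffEndAt I J x) :
    (∀ X Y : Π y : M, TangentSpace I y, DiffAt I X x → DiffAt I Y x → nijenhuis I J X Y x = 0) ↔
      ∀ u v, nijenhuisAt J x u v = 0 := by
  constructor
  · intro hN u v
    have := hN _ _ (diffAt_constVec I x u) (diffAt_constVec I x v)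
    rwa [nijenhuis_eq hJ (diffAt_constVec I x u) (diffAt_constVec I x v), constVec_self,
      constVec_self] at this
  · intro hN X Y hX hY
    rw [nijenhuis_eq hJ hX hY]
    exact hN _ _

lemma SmoothEndo.diffEndAt (hJ : SmoothEndo I J) (x : M) : DiffEndAt I J x :=
  (smoothEndo_iff.1 hJ x).mdifferentiableAt (by simp)

/-- Kähler-with-torsion structures without reference to a connection: `J` is a Hermitian complex
structure and the torsion is `dΩ(J·, J·, J·)`, with `Ω` the fundamental form. -/
theorem isKT_iff [FiniteDimensional ℝ E] (hh : ∀ x, DiffFormAt I h x)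
    (hs : ∀ y v w, h y v w = h y w v) (hnd : ∀ y v, (∀ w, h y v w = 0) → v = 0) :
    IsKT I h J B ↔ SmoothEndo I J ∧ (∀ y v, J y (J y v) = -v) ∧
      (∀ y v w, h y (J y v) (J y w) = h y v w) ∧ TotallySkew I B ∧
      (∀ y u v, nijenhuisAt J y u v = 0) ∧
      ∀ y u v w, B y u v w =
        dTwo (STGeom.fundamentalForm I h J) y (J y u) (J y v) (J y w) := by
  have hsk : (∀ y v, J y (J y v) = -v) → (∀ y v w, h y (J y v) (J y w) = h y v w) →
      ∀ y v w, h y (J y v) w = - h y v (J y w) := by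
    intro hsq hher y v w
    rw [← hher y v (J y w), hsq, map_neg, neg_neg]
  constructor
  · rintro ⟨⟨hsm, hsq, hint⟩, hher, hbis⟩
    have hJ := hsm.diffEndAt
    have hsk' := hsk hsq hher
    have hN := fun y ↦ (nijenhuis_eq_zero_iff (hJ y)).1 (hint y)
    have := (isBismutTorsion_iff hh hs hnd hJ hsk').1 hbis
    exact ⟨hsm, hsq, hher, this.1, hN, fun y ↦
      (lcDerivEnd_eq_iff (hh y) hs (hJ y) hsq hsk' (hN y) this.1).1 (this.2 y)⟩
  · rintro ⟨hsm, hsq, hher, hB, hN, hBD⟩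
    have hJ := hsm.diffEndAt
    have hsk' := hsk hsq hher
    exact ⟨⟨hsm, hsq, fun y ↦ (nijenhuis_eq_zero_iff (hJ y)).2 (hN y)⟩, hher,
      (isBismutTorsion_iff hh hs hnd hJ hsk').2 ⟨hB, fun y ↦
        (lcDerivEnd_eq_iff (hh y) hs (hJ y) hsq hsk' (hN y) hB).2 (hBD y)⟩⟩

/-- The Bismut torsion is of type `(2,1) + (1,2)`. -/
lemma IsKT.torsion_type [FiniteDimensional ℝ E] (hKT : IsKT I h J B) (hh : ∀ x, DiffFormAt I h x)
    (hs : ∀ y v w, h y v w = h y w v) (hnd : ∀ y v, (∀ w, h y v w = 0) → v = 0)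
    (u v w : TangentSpace I x) :
    B x u v w = B x u (J x v) (J x w) + B x (J x u) v (J x w) + B x (J x u) (J x v) w := by
  obtain ⟨⟨hsm, hsq, hint⟩, hher, hbis⟩ := hKT
  have hsk : ∀ y v w, h y (J y v) w = - h y v (J y w) := by
    intro y v w
    rw [← hher y v (J y w), hsq, map_neg, neg_neg]
  have hN := (nijenhuis_eq_zero_iff (hsm.diffEndAt x)).1 (hint x)
  obtain ⟨hB, hK⟩ := (isBismutTorsion_iff hh hs hnd hsm.diffEndAt hsk).1 hbis
  have n := lcDerivEnd_nijenhuis (hh x) hs hsq hsk hN u v w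
  simp only [hK, hsq, tri_neg₃] at n
  linarith [hB.1 x v u w, hB.1 x (J x v) (J x u) w, hB.1 x (J x v) u (J x w),
    hB.1 x v (J x u) (J x w)]

end KTAlgebra

/-! ### The product charts of the cone -/

section ConeCalculus

lemma radius_pos {M : Type*} (p : Cone M) : 0 < radius p := p.2.2

variable {E : Type*} [NormedAddCommGroup E] [NormedSpace ℝ E]
  {H : Type*} [TopologicalSpace H] (I : ModelWithCorners ℝ E H)
  {M : Type*} [TopologicalSpace M] [ChartedSpace H M]

lemma dproj_apply (p : Cone M) (v : TangentSpace (coneModel I) p) :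
    dproj I p v = (show E × ℝ from v).1 := by
  unfold dproj
  rw [mfderiv_fst]
  rfl

lemma mdifferentiableAt_posReals_val (r : posReals) :
    MDifferentiableAt 𝓘(ℝ, ℝ) 𝓘(ℝ, ℝ) (Subtype.val : posReals → ℝ) r := by
  exact (contMDiff_subtype_val (n := ∞) r).mdifferentiableAt (by simp)

lemma mfderiv_val (r s : posReals) (v : TangentSpace 𝓘(ℝ, ℝ) s) :
    mfderiv 𝓘(ℝ, ℝ) 𝓘(ℝ, ℝ) (extChartAt 𝓘(ℝ, ℝ) r) s v = (show ℝ from v) := by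
  have : ⇑(extChartAt 𝓘(ℝ, ℝ) r) = extChartAt 𝓘(ℝ, ℝ) s := rfl
  rw [this, mfderiv_extChartAt_self]
  rfl

lemma dr_apply (p : Cone M) (v : TangentSpace (coneModel I) p) :
    dr I p v = (show E × ℝ from v).2 := by
  have h1 : HasMFDerivAt (coneModel I) 𝓘(ℝ, ℝ) (radius : Cone M → ℝ) p _ :=
    (mdifferentiableAt_posReals_val p.2).hasMFDerivAt.comp p
    (mdifferentiableAt_snd (I := I) (I' := 𝓘(ℝ, ℝ))).hasMFDerivAt
  unfold dr mvfderiv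
  rw [h1.mfderiv, mfderiv_snd]
  exact mfderiv_val p.2 p.2 (show E × ℝ from v).2

variable {I}

/-- The tangent vector of the cone with components `a` along `M` and `ρ` along `∂_r`. -/
def coneVec (p : Cone M) (a : TangentSpace I p.1) (ρ : ℝ) : TangentSpace (coneModel I) p :=
  ((a, ρ) : E × ℝ)

lemma dproj_coneVec (p : Cone M) (a : TangentSpace I p.1) (ρ : ℝ) :
    dproj I p (coneVec p a ρ) = a := dproj_apply I p _

lemma dr_coneVec (p : Cone M) (a : TangentSpace I p.1) (ρ : ℝ) :
    dr I p (coneVec p a ρ) = ρ := dr_apply I p _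

lemma cone_ext {p : Cone M} {u v : TangentSpace (coneModel I) p} (h₁ : dproj I p u = dproj I p v)
    (h₂ : dr I p u = dr I p v) : u = v := by
  rw [dproj_apply, dproj_apply] at h₁
  rw [dr_apply, dr_apply] at h₂
  exact Prod.ext h₁ h₂

lemma coneVec_dproj_dr {p : Cone M} (u : TangentSpace (coneModel I) p) :
    coneVec p (dproj I p u) (dr I p u) = u := cone_ext (dproj_coneVec _ _ _) (dr_coneVec _ _ _)

variable (I)

variable {F : Type*} [NormedAddCommGroup F] [NormedSpace ℝ F]

lemma mdifferentiableAt_comp_fst {f : M → F} {p : Cone M} (hf : MDifferentiableAt I 𝓘(ℝ, F) f p.1) :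
    MDifferentiableAt (coneModel I) 𝓘(ℝ, F) (fun q : Cone M ↦ f q.1) p :=
  hf.comp p mdifferentiableAt_fst

lemma mvfderiv_comp_fst {f : M → F} {p : Cone M} (hf : MDifferentiableAt I 𝓘(ℝ, F) f p.1)
    (u : TangentSpace (coneModel I) p) :
    mvfderiv (coneModel I) (fun q : Cone M ↦ f q.1) p u = mvfderiv I f p.1 (dproj I p u) := by
  have h1 : HasMFDerivAt (coneModel I) 𝓘(ℝ, F) (fun q : Cone M ↦ f q.1) p _ :=
    hf.hasMFDerivAt.comp p (mdifferentiableAt_fst (I := I) (I' := 𝓘(ℝ, ℝ))).hasMFDerivAt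
  unfold mvfderiv
  rw [h1.mfderiv]
  rfl

lemma contMDiff_radius : ContMDiff (coneModel I) 𝓘(ℝ, ℝ) ∞ (radius : Cone M → ℝ) :=
  contMDiff_subtype_val.comp contMDiff_snd

lemma mdifferentiableAt_radius (p : Cone M) :
    MDifferentiableAt (coneModel I) 𝓘(ℝ, ℝ) (radius : Cone M → ℝ) p :=
  (contMDiff_radius I p).mdifferentiableAt (by simp)

lemma mvfderiv_clm_comp {F₁ F₂ : Type*} [NormedAddCommGroup F₁] [NormedSpace ℝ F₁]
    [NormedAddCommGroup F₂] [NormedSpace ℝ F₂] (L : F₁ →L[ℝ] F₂) {f : M → F₁} {x : M}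
    (hf : MDifferentiableAt I 𝓘(ℝ, F₁) f x) (u : TangentSpace I x) :
    mvfderiv I (fun y ↦ L (f y)) x u = L (mvfderiv I f x u) := by
  rw [mvfderiv_clm_apply I (f := fun _ ↦ L) mdifferentiableAt_const hf, mvfderiv_const]
  simp

lemma mdifferentiableAt_radius_inv (p : Cone M) :
    MDifferentiableAt (coneModel I) 𝓘(ℝ, ℝ) (fun q : Cone M ↦ (radius q)⁻¹) p :=
  (differentiableAt_inv (radius_pos p).ne').mdifferentiableAt.comp p (mdifferentiableAt_radius I p)

lemma mvfderiv_radius_inv (p : Cone M) (u : TangentSpace (coneModel I) p) :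
    mvfderiv (coneModel I) (fun q : Cone M ↦ (radius q)⁻¹) p u = -(dr I p u / radius p ^ 2) := by
  have hr := (radius_pos p).ne'
  have d := congrArg (fun L ↦ L u) (mvfderiv_fun_mul (mdifferentiableAt_radius I p)
    (mdifferentiableAt_radius_inv I p))
  have e : (fun q : Cone M ↦ radius q * (radius q)⁻¹) = fun _ ↦ (1 : ℝ) :=
    funext fun q ↦ mul_inv_cancel₀ (radius_pos q).ne'
  rw [e, mvfderiv_const] at d
  simp only [zero_apply, add_apply, smul_apply, smul_eq_mul] at d
  change _ = _ + _ * dr I p u at d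
  field_simp at d ⊢
  linarith

lemma mvfderiv_const_add_radius_sq_mul (c : ℝ) {f : Cone M → ℝ} {p : Cone M}
    (hf : MDifferentiableAt (coneModel I) 𝓘(ℝ, ℝ) f p) (u : TangentSpace (coneModel I) p) :
    mvfderiv (coneModel I) (fun q ↦ c + radius q ^ 2 * f q) p u =
      2 * radius p * dr I p u * f p + radius p ^ 2 * mvfderiv (coneModel I) f p u := by
  have hr := mdifferentiableAt_radius I p
  have e : (fun q ↦ c + radius q ^ 2 * f q) = fun q ↦ c + radius q * (radius q * f q) := by
    funext q; ring
  have d := congrArg (fun L ↦ L u) (mvfderiv_fun_add (mdifferentiableAt_const (c := c))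
    (hr.mul (hr.mul hf)))
  have d₁ := congrArg (fun L ↦ L u) (mvfderiv_fun_mul hr (hr.mul hf))
  have d₂ := congrArg (fun L ↦ L u) (mvfderiv_fun_mul hr hf)
  have z : mvfderiv (coneModel I) (fun _ : Cone M ↦ c) p u = 0 := by
    rw [mvfderiv_const, zero_apply]
  have D : mvfderiv (coneModel I) (fun q ↦ c + radius q * (radius q * f q)) p u
      = 0 + (radius p * (radius p * mvfderiv (coneModel I) f p u + f p * dr I p u)
        + (radius p * f p) * dr I p u) :=
    d.trans (congrArg₂ (fun a b : ℝ ↦ a + b) z (d₁.trans (congrArg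
      (fun a : ℝ ↦ radius p * a + (radius p * f p) * dr I p u) d₂)))
  rw [e, D]
  ring

variable [IsManifold I ∞ M]

lemma mem_chart_cone {p q : Cone M} (hq : q.1 ∈ (chartAt H p.1).source) :
    q ∈ (chartAt (ModelProd H ℝ) p).source := by
  refine ⟨hq, ?_⟩
  simp [TopologicalSpace.Opens.chartAt_eq, chartAt_self_eq]

/-- The charts of the cone are products, and the chart of `(0, ∞)` is the inclusion into `ℝ`. -/
lemma cone_coord {p q : Cone M} (hq : q.1 ∈ (chartAt H p.1).source)
    (v : TangentSpace (coneModel I) q) :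
    (trivializationAt (E × ℝ) (TangentSpace (coneModel I)) p).continuousLinearMapAt ℝ q v
      = ((trivializationAt E (TangentSpace I) p.1).continuousLinearMapAt ℝ q.1 (dproj I q v),
        dr I q v) := by
  rw [TangentBundle.continuousLinearMapAt_trivializationAt (mem_chart_cone hq),
    TangentBundle.continuousLinearMapAt_trivializationAt hq]
  have h1 : HasMFDerivAt (coneModel I) 𝓘(ℝ, E) (fun q : Cone M ↦ extChartAt I p.1 q.1) q _ :=
    (mdifferentiableAt_extChartAt (I := I) hq).hasMFDerivAt.comp q
      (mdifferentiableAt_fst (I := I) (I' := 𝓘(ℝ, ℝ))).hasMFDerivAt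
  have h2 : HasMFDerivAt (coneModel I) 𝓘(ℝ, ℝ) (fun q : Cone M ↦ extChartAt 𝓘(ℝ, ℝ) p.2 q.2) q _ :=
    (mdifferentiableAt_posReals_val q.2).hasMFDerivAt.comp q
      (mdifferentiableAt_snd (I := I) (I' := 𝓘(ℝ, ℝ))).hasMFDerivAt
  have h3 : ⇑(extChartAt (coneModel I) p)
      = fun q : Cone M ↦ (extChartAt I p.1 q.1, extChartAt 𝓘(ℝ, ℝ) p.2 q.2) := by
    rw [extChartAt_prod]; rfl
  have h4 : HasMFDerivAt (coneModel I) 𝓘(ℝ, E × ℝ)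
      (fun q : Cone M ↦ (extChartAt I p.1 q.1, extChartAt 𝓘(ℝ, ℝ) p.2 q.2)) q _ :=
    ⟨h1.1.prodMk h2.1, h1.2.prodMk h2.2⟩
  rw [h3]
  refine (congrArg (fun L : (E × ℝ) →L[ℝ] (E × ℝ) ↦ L v) h4.mfderiv).trans ?_
  exact Prod.ext rfl (congrArg (fun L : (E × ℝ) →L[ℝ] ℝ ↦ L v) h2.mfderiv).symm

lemma chartVec_cone {p q : Cone M} (hq : q.1 ∈ (chartAt H p.1).source)
    (Y : Π y : Cone M, TangentSpace (coneModel I) y) :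
    chartVec (coneModel I) p Y q =
      ((trivializationAt E (TangentSpace I) p.1).continuousLinearMapAt ℝ q.1 (dproj I q (Y q)),
      dr I q (Y q)) := by
  rw [chartVec_eq _ (mem_chart_cone hq), cone_coord I hq]

lemma chartFrame_cone {p q : Cone M} (hq : q.1 ∈ (chartAt H p.1).source) (v : E × ℝ) :
    chartFrame (coneModel I) p q v = coneVec q (chartFrame I p.1 q.1 v.1) v.2 := by
  have h1 := chartVec_chartFrame (coneModel I) (mem_chart_cone hq) v
  have h2 := cone_coord I hq (coneVec q (chartFrame I p.1 q.1 v.1) v.2)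
  rw [dproj_coneVec, dr_coneVec, chartVec_chartFrame I hq] at h2
  have h3 := congrArg ((trivializationAt (E × ℝ) (TangentSpace (coneModel I)) p).symmL ℝ q)
    (h1.trans h2.symm)
  rwa [Trivialization.symmL_continuousLinearMapAt _ (mem_chart_cone hq),
    Trivialization.symmL_continuousLinearMapAt _ (mem_chart_cone hq)] at h3

lemma eventually_cone_mem_chart (p : Cone M) :
    ∀ᶠ q : Cone M in nhds p, q.1 ∈ (chartAt H p.1).source :=
  continuous_fst.continuousAt.eventually (eventually_mem_chart (H := H) p.1)

end ConeCalculus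

/-! ### Derivatives of tensor fields on the cone -/

section ConeTensors
variable {E : Type*} [NormedAddCommGroup E] [NormedSpace ℝ E]
  {H : Type*} [TopologicalSpace H] {I : ModelWithCorners ℝ E H}
  {M : Type*} [TopologicalSpace M] [ChartedSpace H M] [IsManifold I ∞ M]

lemma constVec_cone {p q : Cone M} (hq : q.1 ∈ (chartAt H p.1).source)
    (v : TangentSpace (coneModel I) p) :
    constVec (coneModel I) p v q = coneVec q (constVec I p.1 (dproj I p v) q.1) (dr I p v) := by
  rw [dproj_apply, dr_apply]
  exact chartFrame_cone I hq v

variable {g : Π y : M, TangentSpace I y →L[ℝ] TangentSpace I y →L[ℝ] ℝ}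

lemma DiffFormAt.coneMetric {p : Cone M} (hg : DiffFormAt I g p.1) :
    DiffFormAt (coneModel I) (coneMetric I g) p := by
  have e : chartForm (coneModel I) (STGeom.coneMetric I g) p =ᶠ[nhds p] fun q ↦
      (ContinuousLinearMap.snd ℝ E ℝ).smulRight (ContinuousLinearMap.snd ℝ E ℝ) +
      (radius q ^ 2) • (ContinuousLinearMap.precomp ℝ (ContinuousLinearMap.fst ℝ E ℝ)).comp
        ((chartForm I g p.1 q.1).comp (ContinuousLinearMap.fst ℝ E ℝ)) := by
    filter_upwards [eventually_cone_mem_chart (H := H) p] with q hq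
    refine ContinuousLinearMap.ext fun v ↦ ContinuousLinearMap.ext fun w ↦ ?_
    change STGeom.coneMetric I g q (chartFrame (coneModel I) p q v)
      (chartFrame (coneModel I) p q w) = _
    rw [chartFrame_cone I hq, chartFrame_cone I hq, coneMetric_apply]
    simp only [dproj_coneVec, dr_coneVec]
    rfl
  refine MDifferentiableAt.congr_of_eventuallyEq ?_ e
  have h1 := mdifferentiableAt_comp_fst I hg
  have h2 := mdifferentiableAt_radius I p
  refine mdifferentiableAt_const.add ((h2.pow 2).smul ?_)
  exact mdifferentiableAt_const.clm_comp (h1.clm_comp mdifferentiableAt_const)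

lemma dForm_coneMetric {p : Cone M} (hg : DiffFormAt I g p.1)
    (u v w : TangentSpace (coneModel I) p) :
    dForm (coneModel I) (coneMetric I g) p u v w =
      2 * radius p * dr I p u * g p.1 (dproj I p v) (dproj I p w)
      + radius p ^ 2 * dForm I g p.1 (dproj I p u) (dproj I p v) (dproj I p w) := by
  rw [← mvfderiv_form_constVec hg.coneMetric]
  have e : (fun q ↦ coneMetric I g q (constVec (coneModel I) p v q) (constVec (coneModel I) p w q))
     =ᶠ[nhds p] fun q ↦ dr I p v * dr I p w + radius q ^ 2 *
      (g q.1 (constVec I p.1 (dproj I p v) q.1) (constVec I p.1 (dproj I p w) q.1)) := by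
    filter_upwards [eventually_cone_mem_chart (H := H) p] with q hq
    rw [constVec_cone hq, constVec_cone hq, coneMetric_apply]
    simp only [dproj_coneVec, dr_coneVec]
  rw [mvfderiv_congr _ e]
  have h1 := hg.mdifferentiableAt_apply (diffAt_constVec I p.1 (dproj I p v))
    (diffAt_constVec I p.1 (dproj I p w))
  have h3 := mdifferentiableAt_comp_fst I h1
  have d1 := mvfderiv_comp_fst I h1 u
  rw [mvfderiv_form_constVec hg] at d1
  rw [mvfderiv_const_add_radius_sq_mul I _ h3, d1, constVec_self, constVec_self]

lemma dproj_dVec {p : Cone M} {Y : Π q : Cone M, TangentSpace (coneModel I) q}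
    (hY : DiffAt (coneModel I) Y p) (u : TangentSpace (coneModel I) p) :
    dproj I p (dVec (coneModel I) Y p u) = mvfderiv (coneModel I)
      (fun q ↦ (chartVec (coneModel I) p Y q).1) p u := by
  rw [dproj_apply]
  exact (mvfderiv_clm_comp (coneModel I) (ContinuousLinearMap.fst ℝ E ℝ)
    ((diffAt_iff _).1 hY) u).symm

lemma dr_dVec {p : Cone M} {Y : Π q : Cone M, TangentSpace (coneModel I) q}
    (hY : DiffAt (coneModel I) Y p) (u : TangentSpace (coneModel I) p) :
    dr I p (dVec (coneModel I) Y p u) = mvfderiv (coneModel I) (fun q ↦ dr I q (Y q)) p u := by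
  have e : (fun q ↦ dr I q (Y q)) =ᶠ[nhds p] fun q ↦ (chartVec (coneModel I) p Y q).2 := by
    filter_upwards [eventually_cone_mem_chart (H := H) p] with q hq
    rw [chartVec_cone I hq]
  rw [dr_apply, mvfderiv_congr _ e]
  exact (mvfderiv_clm_comp (coneModel I) (ContinuousLinearMap.snd ℝ E ℝ)
    ((diffAt_iff _).1 hY) u).symm

section Induced

variable {S : ContactTriple I M}
    {J : Π p : Cone M, TangentSpace (coneModel I) p →L[ℝ] TangentSpace (coneModel I) p}

lemma InducesOnCone.chartEnd_apply (hJ : InducesOnCone S J) {p q : Cone M}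
    (hq : q.1 ∈ (chartAt H p.1).source) (v : E × ℝ) :
    chartEnd (coneModel I) J p q v =
      (chartEnd I S.Φ p.1 q.1 v.1 + (v.2 * (radius q)⁻¹) • chartVec I p.1 S.ξ q.1,
        - (radius q * chartCovec I S.η p.1 q.1 v.1)) := by
  refine (cone_coord I hq (J q (chartFrame (coneModel I) p q v))).trans ?_
  rw [chartFrame_cone I hq, (hJ _ _).1, (hJ _ _).2, dproj_coneVec, dr_coneVec, map_add, map_smul,
    ← chartVec_eq I hq]
  rfl

lemma InducesOnCone.smoothEndo (hJ : InducesOnCone S J) : SmoothEndo (coneModel I) J := by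
  rw [smoothEndo_iff]
  intro p
  have e : chartEnd (coneModel I) J p =ᶠ[nhds p] fun q ↦
      (ContinuousLinearMap.inl ℝ E ℝ).comp
        ((chartEnd I S.Φ p.1 q.1).comp (ContinuousLinearMap.fst ℝ E ℝ)) +
      (radius q)⁻¹ • (ContinuousLinearMap.inl ℝ E ℝ).comp
        (ContinuousLinearMap.smulRightL ℝ (E × ℝ) E (ContinuousLinearMap.snd ℝ E ℝ)
          (chartVec I p.1 S.ξ q.1)) -
      radius q • (ContinuousLinearMap.inr ℝ E ℝ).comp
        ((chartCovec I S.η p.1 q.1).comp (ContinuousLinearMap.fst ℝ E ℝ)) := by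
    filter_upwards [eventually_cone_mem_chart (H := H) p] with q hq
    refine ContinuousLinearMap.ext fun v ↦ ?_
    rw [hJ.chartEnd_apply hq]
    ext
    · simpa [mul_smul] using smul_comm _ _ _
    · simp
  refine ContMDiffAt.congr_of_eventuallyEq ?_ e
  have h1 : ContMDiffAt (coneModel I) 𝓘(ℝ, E →L[ℝ] E) ∞
      (fun q : Cone M ↦ chartEnd I S.Φ p.1 q.1) p :=
    (smoothEndo_iff.1 S.smooth_Φ p.1).comp p contMDiffAt_fst
  have h2 : ContMDiffAt (coneModel I) 𝓘(ℝ, E →L[ℝ] ℝ) ∞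
      (fun q : Cone M ↦ chartCovec I S.η p.1 q.1) p :=
    (smoothCovec_iff.1 S.smooth_η p.1).comp p contMDiffAt_fst
  have h3 : ContMDiffAt (coneModel I) 𝓘(ℝ, E) ∞ (fun q : Cone M ↦ chartVec I p.1 S.ξ q.1) p :=
    (smoothVec_iff.1 S.smooth_ξ p.1).comp p contMDiffAt_fst
  have h4 := contMDiff_radius (M := M) I p
  have h5 : ContMDiffAt (coneModel I) 𝓘(ℝ, ℝ) ∞ (fun q : Cone M ↦ (radius q)⁻¹) p :=
    (contDiffAt_inv ℝ (radius_pos p).ne').contMDiffAt.comp p h4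
  refine ((contMDiffAt_const.clm_comp (h1.clm_comp contMDiffAt_const)).add (h5.smul
    (contMDiffAt_const.clm_comp (contMDiffAt_const.clm_apply h3)))).sub
    (h4.smul (contMDiffAt_const.clm_comp (h2.clm_comp contMDiffAt_const)))

lemma ContactTriple.diffCovecAt_eta (S : ContactTriple I M) (x : M) : DiffCovecAt I S.η x :=
  (smoothCovec_iff.1 S.smooth_η x).mdifferentiableAt (by simp)

lemma ContactTriple.diffAt_xi (S : ContactTriple I M) (x : M) : DiffAt I S.ξ x :=
  (S.smooth_ξ x).mdifferentiableAt (by simp)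

lemma InducesOnCone.dproj_dEnd (hJ : InducesOnCone S J) {p : Cone M}
    (u v : TangentSpace (coneModel I) p) :
    dproj I p (dEnd (coneModel I) J p u v) =
      dEnd I S.Φ p.1 (dproj I p u) (dproj I p v)
      + ((dr I p v / radius p) • dVec I S.ξ p.1 (dproj I p u)
        - (dr I p u * dr I p v / radius p ^ 2) • S.ξ p.1) := by
  have hJd := hJ.smoothEndo.diffEndAt p
  have hΦ := S.smooth_Φ.diffEndAt p.1
  have hξ := (diffAt_iff I).1 (S.diffAt_xi p.1)
  have hv := diffAt_constVec (coneModel I) p v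
  have e1 := hJd.dVec_apply hv u
  rw [dVec_constVec, zero_apply, map_zero, add_zero, constVec_self] at e1
  have hpv := diffAt_constVec I p.1 (dproj I p v)
  have e : (fun q ↦ (chartVec (coneModel I) p (fun y ↦ J y (constVec (coneModel I) p v y)) q).1)
      =ᶠ[nhds p] fun q ↦ chartVec I p.1 (fun y ↦ S.Φ y (constVec I p.1 (dproj I p v) y)) q.1
        + (dr I p v * (radius q)⁻¹) • chartVec I p.1 S.ξ q.1 := by
    filter_upwards [eventually_cone_mem_chart (H := H) p] with q hq
    rw [chartVec_cone I hq, (hJ _ _).1, constVec_cone hq, dproj_coneVec, dr_coneVec, map_add,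
      map_smul, chartVec_eq I hq, chartVec_eq I hq]
    rfl
  rw [← e1, dproj_dVec (hJd.diffAt_apply hv), mvfderiv_congr _ e]
  have h1 := (diffAt_iff I).1 (hΦ.diffAt_apply hpv)
  have h2 : MDifferentiableAt (coneModel I) 𝓘(ℝ, ℝ) (fun q : Cone M ↦ dr I p v * (radius q)⁻¹) p :=
    mdifferentiableAt_const.mul (mdifferentiableAt_radius_inv I p)
  have h3 := mdifferentiableAt_comp_fst I hξ
  have d1 := congrArg (fun L ↦ L u) (mvfderiv_fun_add (I := coneModel I)
    (mdifferentiableAt_comp_fst I h1) (h2.smul h3))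
  have d2 := congrArg (fun L ↦ L u) (mvfderiv_fun_smul h2 h3)
  have d3 := mvfderiv_comp_fst I h1 u
  have d4 := mvfderiv_comp_fst I hξ u
  have d5 := mvfderiv_clm_comp (coneModel I)
    (ContinuousLinearMap.mul ℝ ℝ (dr I p v)) (mdifferentiableAt_radius_inv I p) u
  have d6 := hΦ.dVec_apply hpv (dproj I p u)
  rw [dVec_constVec, zero_apply, map_zero, add_zero, constVec_self] at d6
  refine d1.trans (congrArg₂ (fun a b : E ↦ a + b) (d3.trans d6) (d2.trans ?_))
  rw [sub_eq_add_neg, ← neg_smul]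
  refine congrArg₂ (fun a b : E ↦ a + b) (congrArg (fun a : E ↦ (dr I p v / radius p) • a) d4) ?_
  refine congrArg₂ (fun (a : ℝ) (b : E) ↦ a • b) (d5.trans ?_) (chartVec_self I p.1 S.ξ)
  rw [mvfderiv_radius_inv I, ContinuousLinearMap.mul_apply']
  ring

lemma InducesOnCone.dr_dEnd (hJ : InducesOnCone S J) {p : Cone M}
    (u v : TangentSpace (coneModel I) p) :
    dr I p (dEnd (coneModel I) J p u v) =
      - (dr I p u * S.η p.1 (dproj I p v))
      - radius p * dCovec I S.η p.1 (dproj I p u) (dproj I p v) := by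
  have hJd := hJ.smoothEndo.diffEndAt p
  have hη := S.diffCovecAt_eta p.1
  have hv := diffAt_constVec (coneModel I) p v
  have e1 := hJd.dVec_apply hv u
  rw [dVec_constVec, zero_apply, map_zero, add_zero, constVec_self] at e1
  have hpv := diffAt_constVec I p.1 (dproj I p v)
  have e : (fun q ↦ dr I q (J q (constVec (coneModel I) p v q)))
      =ᶠ[nhds p] fun q ↦ -(radius q * S.η q.1 (constVec I p.1 (dproj I p v) q.1)) := by
    filter_upwards [eventually_cone_mem_chart (H := H) p] with q hq
    rw [(hJ _ _).2, constVec_cone hq, dproj_coneVec]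
  rw [← e1, dr_dVec (hJd.diffAt_apply hv), mvfderiv_congr _ e, mvfderiv_fun_neg]
  have h1 := hη.mdifferentiableAt_apply hpv
  have d1 := congrArg (fun L ↦ L u) (mvfderiv_fun_mul (mdifferentiableAt_radius I p)
    (mdifferentiableAt_comp_fst I h1))
  have d3 := mvfderiv_comp_fst I h1 u
  rw [hη.mvfderiv_apply hpv, dVec_constVec, zero_apply, map_zero, add_zero, constVec_self] at d3
  simp only [add_apply, smul_apply, smul_eq_mul] at d1
  rw [neg_apply, d1, d3, constVec_self]
  change - (_ + _ * dr I p u) = _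
  ring

end Induced

end ConeTensors

/-! ### The radial equation: reading off the triple from `J` -/

section Ray
variable {E : Type*} [NormedAddCommGroup E] [NormedSpace ℝ E]
  {H : Type*} [TopologicalSpace H] {I : ModelWithCorners ℝ E H}
  {M : Type*} [TopologicalSpace M] [ChartedSpace H M]

lemma coneVec_add_radial (p : Cone M) (a : TangentSpace I p.1) (ρ : ℝ) :
    coneVec p a ρ = coneVec p a 0 + coneVec p 0 ρ :=
  cone_ext (by simp only [map_add, dproj_coneVec, add_zero])
    (by simp only [map_add, dr_coneVec, zero_add])

/-- The exponential as a map onto `(0, ∞)`; in the parameter `t = log r` the radial equation for `J`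
has constant coefficients. -/
def expPos (t : ℝ) : posReals := ⟨Real.exp t, Real.exp_pos t⟩

lemma contMDiff_ray (x : M) :
    ContMDiff 𝓘(ℝ, ℝ) (coneModel I) ∞ (fun t ↦ ((x, expPos t) : Cone M)) := by
  refine contMDiff_const.prodMk ?_
  refine (ContMDiff.subtypeVal_comp_iff posReals expPos).1 ?_
  exact Real.contDiff_exp.contMDiff

lemma mfderiv_ray (x : M) (t : ℝ) :
    mfderiv 𝓘(ℝ, ℝ) (coneModel I) (fun t ↦ ((x, expPos t) : Cone M)) t (1 : ℝ)
     = coneVec (I := I) ((x, expPos t) : Cone M) 0 (Real.exp t) := by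
  have h := (contMDiff_ray (I := I) x t).mdifferentiableAt (by simp)
  refine cone_ext ?_ ?_
  · have h1 := mfderiv_comp_apply t (mdifferentiableAt_fst (I := I) (I' := 𝓘(ℝ, ℝ))
      (x := ((x, expPos t) : Cone M))) h (1 : ℝ)
    rw [dproj_coneVec]
    refine h1.symm.trans ?_
    have e : (Prod.fst ∘ fun t ↦ ((x, expPos t) : Cone M)) = fun _ ↦ x := rfl
    rw [e, mfderiv_const]
    rfl
  · have h1 := mfderiv_comp_apply t (mdifferentiableAt_radius I ((x, expPos t) : Cone M)) h (1 : ℝ)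
    rw [dr_coneVec]
    refine h1.symm.trans ?_
    have e : (radius ∘ fun t ↦ ((x, expPos t) : Cone M)) = Real.exp := rfl
    rw [e, mfderiv_eq_fderiv]
    exact (congrArg (fun L : ℝ →L[ℝ] ℝ ↦ L 1) (Real.hasDerivAt_exp t).hasFDerivAt.fderiv).trans
      (by simp)

end Ray

section ConeMetric
variable {E : Type*} [NormedAddCommGroup E] [NormedSpace ℝ E]
  {H : Type*} [TopologicalSpace H] {I : ModelWithCorners ℝ E H}
  {M : Type*} [TopologicalSpace M] [ChartedSpace H M] [IsManifold I ∞ M]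
  (g : ContMDiffRiemannianMetric I ∞ E (fun y : M ↦ TangentSpace I y))

lemma diffFormAt_metric (x : M) : DiffFormAt I g.inner x :=
  (smoothMetric g x).mdifferentiableAt (by simp)

lemma diffFormAt_coneMetric (p : Cone M) : DiffFormAt (coneModel I) (coneMetric I g.inner) p :=
  (diffFormAt_metric g p.1).coneMetric

lemma coneMetric_symm (p : Cone M) (v w : TangentSpace (coneModel I) p) :
    coneMetric I g.inner p v w = coneMetric I g.inner p w v := by
  rw [coneMetric_apply, coneMetric_apply, g.symm, mul_comm (dr I p v)]

lemma metric_nondegenerate (x : M) (v : TangentSpace I x) (hv : ∀ w, g.inner x v w = 0) :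
    v = 0 := by
  by_contra h
  exact (g.pos x v h).ne' (hv v)

lemma coneMetric_nondegenerate (p : Cone M) (v : TangentSpace (coneModel I) p)
    (hv : ∀ w, coneMetric I g.inner p v w = 0) : v = 0 := by
  refine cone_ext ((metric_nondegenerate g p.1 _ fun a ↦ ?_).trans (map_zero _).symm) ?_
  · have := hv (coneVec p a 0)
    rw [coneMetric_apply, dproj_coneVec, dr_coneVec, mul_zero, zero_add] at this
    exact (mul_eq_zero.1 this).resolve_left (pow_pos (radius_pos p) 2).ne'
  · have := hv (coneVec p 0 1)
    rw [coneMetric_apply, dproj_coneVec, dr_coneVec, map_zero, mul_zero, mul_one, add_zero] at this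
    rw [this, map_zero]

lemma coneTorsion_totallySkew (T : ThreeForm I M) :
    TotallySkew (coneModel I) (coneTorsion I T.toFun) := by
  refine ⟨fun p u v w ↦ ?_, fun p u v w ↦ ?_⟩
  · rw [coneTorsion_apply, coneTorsion_apply, T.skew.1]; ring
  · rw [coneTorsion_apply, coneTorsion_apply, T.skew.2]; ring

variable {g} {T : ThreeForm I M}
  {J : Π p : Cone M, TangentSpace (coneModel I) p →L[ℝ] TangentSpace (coneModel I) p}

/-- The equation `∇J = 0` in the direction `r ∂_r`.  The torsion does not contribute, because `r² T`
vanishes on `∂_r`. -/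
lemma IsSTConeStructure.dEnd_radial [FiniteDimensional ℝ E] (hJ : IsSTConeStructure g T J)
    (p : Cone M) (v : TangentSpace (coneModel I) p) :
    dEnd (coneModel I) J p (coneVec p 0 (radius p)) v =
      J p (coneVec p (dproj I p v) 0) - coneVec p (dproj I p (J p v)) 0 := by
  obtain ⟨⟨hsm, hsq, hint⟩, hher, hbis⟩ := hJ
  have hsk : ∀ y v w, coneMetric I g.inner y (J y v) w = - coneMetric I g.inner y v (J y w) := by
    intro y v w
    rw [← hher y v (J y w), hsq, map_neg, neg_neg]
  have hh := diffFormAt_coneMetric g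
  have hK := ((isBismutTorsion_iff hh (coneMetric_symm g) (coneMetric_nondegenerate g)
    hsm.diffEndAt hsk).1 hbis).2 p (coneVec p 0 (radius p)) v
  rw [← sub_eq_zero]
  refine coneMetric_nondegenerate g p _ fun w ↦ ?_
  have k := hK w
  unfold lcDerivEnd at k
  simp only [dForm_coneMetric (diffFormAt_metric g p.1), dproj_coneVec, dr_coneVec,
    coneTorsion_apply, tri_zero₁, form_zero_left, mul_zero, add_zero, sub_zero, neg_zero] at k
  rw [form_sub_left, form_sub_left, hsk p (coneVec p (dproj I p v) 0)]
  rw [coneMetric_apply I g.inner p (coneVec _ _ _), coneMetric_apply I g.inner p (coneVec _ _ _)]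
  simp only [dproj_coneVec, dr_coneVec]
  linarith

lemma chartCoord_self (x : M) (v : TangentSpace I x) :
    ((trivializationAt E (TangentSpace I) x).continuousLinearMapAt ℝ x v : E) = v := by
  have h := chartVec_chartFrame I (mem_chart_source H x) v
  exact (congrArg (fun w ↦ (trivializationAt E (TangentSpace I) x).continuousLinearMapAt ℝ x w)
    (chartFrame_self I x v).symm).trans h

lemma chartEnd_cone {p q : Cone M} (hq : q.1 ∈ (chartAt H p.1).source) (v : E × ℝ) :
    (chartEnd (coneModel I) J p q v : E × ℝ) =
      ((trivializationAt E (TangentSpace I) p.1).continuousLinearMapAt ℝ q.1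
        (dproj I q (J q (coneVec q (chartFrame I p.1 q.1 v.1) v.2))),
      dr I q (J q (coneVec q (chartFrame I p.1 q.1 v.1) v.2))) := by
  refine (cone_coord I hq (J q (chartFrame (coneModel I) p q v))).trans ?_
  rw [chartFrame_cone I hq]

/-- Along a ray the chart of the cone centred at a point of that ray is the identity, so the
components of `J` are compared there without any change of frame. -/
lemma chartEnd_cone_same (x : M) (r s : posReals) (a : TangentSpace I x) (ρ : ℝ) :
    (chartEnd (coneModel I) J ((x, r) : Cone M) ((x, s) : Cone M) ((a, ρ) : E × ℝ) : E × ℝ) =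
      ((dproj I ((x, s) : Cone M) (J (x, s) (coneVec ((x, s) : Cone M) a ρ)) : E),
      dr I ((x, s) : Cone M) (J (x, s) (coneVec ((x, s) : Cone M) a ρ))) := by
  have hx : ((x, s) : Cone M).1 ∈ (chartAt H ((x, r) : Cone M).1).source := mem_chart_source H x
  refine (chartEnd_cone hx _).trans ?_
  have e : (chartFrame I x x a : E) = a := chartFrame_self I x a
  refine Eq.trans ?_ (congrArg (fun b : E ↦
    (b, dr I ((x, s) : Cone M) (J (x, s) (coneVec ((x, s) : Cone M) a ρ))))
    (chartCoord_self x (dproj I ((x, s) : Cone M) (J (x, s) (coneVec ((x, s) : Cone M) a ρ)))))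
  exact congrArg (fun b : E ↦
    ((trivializationAt E (TangentSpace I) x).continuousLinearMapAt ℝ x
        (dproj I ((x, s) : Cone M) (J (x, s) (coneVec ((x, s) : Cone M) b ρ))),
      dr I ((x, s) : Cone M) (J (x, s) (coneVec ((x, s) : Cone M) b ρ)))) e

lemma hasDerivAt_ray (hJ : SmoothEndo (coneModel I) J) (x : M) (t : ℝ) (a : TangentSpace I x)
    (ρ : ℝ) :
    HasDerivAt (fun s ↦ (chartEnd (coneModel I) J ((x, expPos t) : Cone M) (x, expPos s)
        ((a, ρ) : E × ℝ) : E × ℝ))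
      (dEnd (coneModel I) J (x, expPos t) (coneVec ((x, expPos t) : Cone M) 0 (Real.exp t))
        (coneVec ((x, expPos t) : Cone M) a ρ) : E × ℝ) t := by
  have hJd := hJ.diffEndAt ((x, expPos t) : Cone M)
  have h1 : MDifferentiableAt (coneModel I) 𝓘(ℝ, E × ℝ) (fun q : Cone M ↦
      (chartEnd (coneModel I) J ((x, expPos t) : Cone M) q ((a, ρ) : E × ℝ) : E × ℝ))
      ((x, expPos t) : Cone M) := hJd.clm_apply mdifferentiableAt_const
  have h2 := (contMDiff_ray (I := I) x t).mdifferentiableAt (by simp)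
  have h3 := (h1.comp t h2).differentiableAt.hasFDerivAt.hasDerivAt
  have e : fderiv ℝ ((fun q : Cone M ↦
      (chartEnd (coneModel I) J ((x, expPos t) : Cone M) q ((a, ρ) : E × ℝ) : E × ℝ)) ∘
        fun s ↦ ((x, expPos s) : Cone M)) t (1 : ℝ) =
      (dEnd (coneModel I) J (x, expPos t) (coneVec ((x, expPos t) : Cone M) 0 (Real.exp t))
        (coneVec ((x, expPos t) : Cone M) a ρ) : E × ℝ) := by
    have h4 := mfderiv_comp_apply t h1 h2 (1 : ℝ)
    rw [mfderiv_ray] at h4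
    refine (congrArg (fun L : ℝ →L[ℝ] E × ℝ ↦ L 1) mfderiv_eq_fderiv.symm).trans (h4.trans ?_)
    have h5 := mvfderiv_clm_apply (coneModel I) hJd
      (mdifferentiableAt_const (c := ((a, ρ) : E × ℝ)))
      (coneVec ((x, expPos t) : Cone M) 0 (Real.exp t))
    rw [mvfderiv_const, zero_apply, map_zero, add_zero] at h5
    exact h5
  rw [e] at h3
  exact h3

variable [FiniteDimensional ℝ E]

/-- The component along `M` of `J (a + ρ ∂_r)` at the point `(x, eᵗ)` of the ray through `x`. -/
def rayProj (J : Π p : Cone M, TangentSpace (coneModel I) p →L[ℝ] TangentSpace (coneModel I) p)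
    (x : M) (a : TangentSpace I x) (ρ t : ℝ) : E :=
  dproj I ((x, expPos t) : Cone M) (J (x, expPos t) (coneVec ((x, expPos t) : Cone M) a ρ))

/-- The component along `∂_r` of `J (a + ρ ∂_r)` at the point `(x, eᵗ)` of the ray through `x`. -/
def rayDr (J : Π p : Cone M, TangentSpace (coneModel I) p →L[ℝ] TangentSpace (coneModel I) p)
    (x : M) (a : TangentSpace I x) (ρ t : ℝ) : ℝ :=
  dr I ((x, expPos t) : Cone M) (J (x, expPos t) (coneVec ((x, expPos t) : Cone M) a ρ))

lemma IsSTConeStructure.dproj_dEnd_radial (hJ : IsSTConeStructure g T J) (p : Cone M)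
    (a : TangentSpace I p.1) (ρ : ℝ) :
    dproj I p (dEnd (coneModel I) J p (coneVec p 0 (radius p)) (coneVec p a ρ)) =
      dproj I p (J p (coneVec p a 0)) - dproj I p (J p (coneVec p a ρ)) := by
  rw [hJ.dEnd_radial, map_sub, dproj_coneVec, dproj_coneVec]

lemma IsSTConeStructure.dr_dEnd_radial (hJ : IsSTConeStructure g T J) (p : Cone M)
    (a : TangentSpace I p.1) (ρ : ℝ) :
    dr I p (dEnd (coneModel I) J p (coneVec p 0 (radius p)) (coneVec p a ρ)) =
      dr I p (J p (coneVec p a 0)) := by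
  rw [hJ.dEnd_radial, map_sub, dproj_coneVec, dr_coneVec, sub_zero]

lemma IsSTConeStructure.hasDerivAt_rayProj (hJ : IsSTConeStructure g T J) (x : M)
    (a : TangentSpace I x) (ρ t : ℝ) :
    HasDerivAt (rayProj J x a ρ) (rayProj J x a 0 t - rayProj J x a ρ t) t := by
  have h := hasDerivAt_ray hJ.complex.smooth x t a ρ
  have e : (fun u ↦ (chartEnd (coneModel I) J ((x, expPos t) : Cone M) (x, expPos u)
      ((a, ρ) : E × ℝ) : E × ℝ)) = fun u ↦ (rayProj J x a ρ u, rayDr J x a ρ u) :=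
    funext fun u ↦ chartEnd_cone_same x _ _ a ρ
  rw [e] at h
  have h' := (ContinuousLinearMap.fst ℝ E ℝ).hasFDerivAt.comp_hasDerivAt t h
  have e' := (dproj_apply I ((x, expPos t) : Cone M) _).symm.trans
    (hJ.dproj_dEnd_radial ((x, expPos t) : Cone M) a ρ)
  exact HasDerivAt.congr_deriv h' e'

lemma IsSTConeStructure.hasDerivAt_rayDr (hJ : IsSTConeStructure g T J) (x : M)
    (a : TangentSpace I x) (ρ t : ℝ) :
    HasDerivAt (rayDr J x a ρ) (rayDr J x a 0 t) t := by
  have h := hasDerivAt_ray hJ.complex.smooth x t a ρ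
  have e : (fun u ↦ (chartEnd (coneModel I) J ((x, expPos t) : Cone M) (x, expPos u)
      ((a, ρ) : E × ℝ) : E × ℝ)) = fun u ↦ (rayProj J x a ρ u, rayDr J x a ρ u) :=
    funext fun u ↦ chartEnd_cone_same x _ _ a ρ
  rw [e] at h
  have h' := (ContinuousLinearMap.snd ℝ E ℝ).hasFDerivAt.comp_hasDerivAt t h
  have e' := (dr_apply I ((x, expPos t) : Cone M) _).symm.trans
    (hJ.dr_dEnd_radial ((x, expPos t) : Cone M) a ρ)
  exact HasDerivAt.congr_deriv h' e'

lemma eq_of_hasDerivAt_zero {F : Type*} [NormedAddCommGroup F] [NormedSpace ℝ F] {f : ℝ → F}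
    (hf : ∀ t, HasDerivAt f 0 t) (s t : ℝ) : f s = f t :=
  is_const_of_deriv_eq_zero (fun t ↦ (hf t).differentiableAt) (fun t ↦ (hf t).deriv) s t

lemma IsSTConeStructure.rayProj_horizontal (hJ : IsSTConeStructure g T J) (x : M)
    (a : TangentSpace I x) (t : ℝ) : rayProj J x a 0 t = rayProj J x a 0 0 :=
  eq_of_hasDerivAt_zero (fun s ↦ by simpa using hJ.hasDerivAt_rayProj x a 0 s) t 0

lemma IsSTConeStructure.rayDr_horizontal (hJ : IsSTConeStructure g T J) (x : M)
    (a : TangentSpace I x) (t : ℝ) : rayDr J x a 0 t = Real.exp t * rayDr J x a 0 0 := by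
  have h := eq_of_hasDerivAt_zero (f := fun s ↦ Real.exp (-s) * rayDr J x a 0 s) (fun s ↦ by
    refine ((hasDerivAt_neg s).exp.mul (hJ.hasDerivAt_rayDr x a 0 s)).congr_deriv ?_
    ring) t 0
  simp only [neg_zero, Real.exp_zero, one_mul] at h
  rw [← h, ← mul_assoc, ← Real.exp_add, add_neg_cancel, Real.exp_zero, one_mul]

lemma IsSTConeStructure.rayProj_radial (hJ : IsSTConeStructure g T J) (x : M) (ρ t : ℝ) :
    rayProj J x (0 : TangentSpace I x) ρ t =
      (ρ / Real.exp t) • rayProj J x (0 : TangentSpace I x) 1 0 := by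
  have z : ∀ s, rayProj J x (0 : TangentSpace I x) 0 s = 0 := fun s ↦ by
    have : coneVec ((x, expPos s) : Cone M) (0 : TangentSpace I x) 0 = 0 := rfl
    unfold rayProj
    rw [this, map_zero, map_zero]
    rfl
  have h := eq_of_hasDerivAt_zero (f := fun s ↦ Real.exp s • rayProj J x (0 : TangentSpace I x) 1 s)
    (fun s ↦ by
      refine ((Real.hasDerivAt_exp s).smul (hJ.hasDerivAt_rayProj x 0 1 s)).congr_deriv ?_
      rw [z, zero_sub, smul_neg, neg_add_cancel]) t 0
  have hρ : rayProj J x (0 : TangentSpace I x) ρ t =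
      ρ • rayProj J x (0 : TangentSpace I x) 1 t := by
    have : coneVec ((x, expPos t) : Cone M) (0 : TangentSpace I x) ρ
        = ρ • coneVec ((x, expPos t) : Cone M) (0 : TangentSpace I x) 1 :=
      cone_ext (by rw [map_smul, dproj_coneVec, dproj_coneVec, smul_zero])
        (by rw [map_smul, dr_coneVec, dr_coneVec, smul_eq_mul, mul_one])
    unfold rayProj
    rw [this, map_smul, map_smul]
    rfl
  simp only [Real.exp_zero, one_smul] at h
  rw [hρ, ← h, smul_smul, div_mul_cancel₀ _ (Real.exp_pos t).ne']

/-- `J ∂_r` is orthogonal to `∂_r`, because `J` is Hermitian. -/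
lemma IsSTConeStructure.dr_radial (hJ : IsSTConeStructure g T J) (p : Cone M) (ρ : ℝ) :
    dr I p (J p (coneVec p 0 ρ)) = 0 := by
  have h₁ := hJ.hermitian p (coneVec p 0 ρ) (J p (coneVec p 0 ρ))
  rw [hJ.complex.sq, map_neg, coneMetric_symm] at h₁
  have h₂ : coneMetric I g.inner p (coneVec p 0 ρ) (J p (coneVec p 0 ρ)) = 0 := by linarith
  rw [coneMetric_apply, dproj_coneVec, dr_coneVec, form_zero_left, mul_zero, add_zero] at h₂
  rcases mul_eq_zero.1 h₂ with h | h
  · have : coneVec p (0 : TangentSpace I p.1) ρ = 0 :=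
      cone_ext (by rw [dproj_coneVec, map_zero]) (by rw [dr_coneVec, h, map_zero])
    rw [this, map_zero, map_zero]
  · exact h

/-- The point of the cone at distance one from the apex over `x`. -/
def unitPoint (x : M) : Cone M := (x, expPos 0)

/-- The horizontal lift of tangent vectors of `M` to the cone. -/
def liftL (p : Cone M) : TangentSpace I p.1 →L[ℝ] TangentSpace (coneModel I) p :=
  ContinuousLinearMap.inl ℝ E ℝ

/-- The triple is read off from `J` at `r = 1`; the radial equation propagates it to the whole
cone. -/
theorem IsSTConeStructure.exists_inducesOnCone (hJ : IsSTConeStructure g T J) :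
    ∃ S : ContactTriple I M, InducesOnCone S J := by
  let ξ : Π x : M, TangentSpace I x := fun x ↦
    dproj I (unitPoint x) (J (unitPoint x) (coneVec (unitPoint x) 0 1))
  let Φ : Π x : M, TangentSpace I x →L[ℝ] TangentSpace I x := fun x ↦
    (dproj I (unitPoint x)).comp ((J (unitPoint x)).comp (liftL (unitPoint x)))
  let η : Π x : M, TangentSpace I x →L[ℝ] ℝ := fun x ↦
    -(dr I (unitPoint x)).comp ((J (unitPoint x)).comp (liftL (unitPoint x)))
  have hu : ContMDiff I (coneModel I) ∞ (unitPoint : M → Cone M) :=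
    contMDiff_id.prodMk contMDiff_const
  have hJs : ∀ x : M, ContMDiffAt I 𝓘(ℝ, E × ℝ →L[ℝ] E × ℝ) ∞
      (fun y ↦ chartEnd (coneModel I) J (unitPoint x) (unitPoint y)) x := fun x ↦
    (smoothEndo_iff.1 hJ.complex.smooth (unitPoint x)).comp x (hu x)
  have hc : ∀ x : M, ∀ᶠ y in nhds x, ∀ v : E × ℝ,
      (chartEnd (coneModel I) J (unitPoint x) (unitPoint y) v : E × ℝ) =
      ((trivializationAt E (TangentSpace I) x).continuousLinearMapAt ℝ y
        (dproj I (unitPoint y) (J (unitPoint y)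
          (coneVec (unitPoint y) (chartFrame I x y v.1) v.2))),
      dr I (unitPoint y) (J (unitPoint y)
          (coneVec (unitPoint y) (chartFrame I x y v.1) v.2))) := by
    intro x
    filter_upwards [eventually_mem_chart (H := H) x] with y hy v
    exact chartEnd_cone (p := unitPoint x) (q := unitPoint y) hy v
  refine ⟨⟨ξ, η, Φ, ?_, ?_, ?_⟩, ?_⟩
  · rw [smoothVec_iff]
    intro x
    refine ContMDiffAt.congr_of_eventuallyEq (f := fun y ↦ ContinuousLinearMap.fst ℝ E ℝ
      (chartEnd (coneModel I) J (unitPoint x) (unitPoint y) ((0, 1) : E × ℝ))) ?_ ?_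
    · exact contMDiffAt_const.clm_apply ((hJs x).clm_apply contMDiffAt_const)
    · filter_upwards [hc x, eventually_mem_chart (H := H) x] with y hy hy'
      rw [hy, chartVec_eq I hy', map_zero]
      rfl
  · rw [smoothCovec_iff]
    intro x
    refine ContMDiffAt.congr_of_eventuallyEq (f := fun y ↦ -(ContinuousLinearMap.snd ℝ E ℝ).comp
      ((chartEnd (coneModel I) J (unitPoint x) (unitPoint y)).comp
        (ContinuousLinearMap.inl ℝ E ℝ))) ?_ ?_
    · exact (contMDiffAt_const.clm_comp ((hJs x).clm_comp contMDiffAt_const)).neg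
    · filter_upwards [hc x] with y hy
      refine ContinuousLinearMap.ext fun v ↦ ?_
      exact congrArg (fun w : E × ℝ ↦ -w.2) (hy (v, 0)).symm
  · rw [smoothEndo_iff]
    intro x
    refine ContMDiffAt.congr_of_eventuallyEq (f := fun y ↦ (ContinuousLinearMap.fst ℝ E ℝ).comp
      ((chartEnd (coneModel I) J (unitPoint x) (unitPoint y)).comp
        (ContinuousLinearMap.inl ℝ E ℝ))) ?_ ?_
    · exact contMDiffAt_const.clm_comp ((hJs x).clm_comp contMDiffAt_const)
    · filter_upwards [hc x] with y hy
      refine ContinuousLinearMap.ext fun v ↦ ?_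
      exact congrArg Prod.fst (hy (v, 0)).symm
  · rintro ⟨x, r⟩ v
    obtain ⟨t, rfl⟩ : ∃ t, r = expPos t :=
      ⟨Real.log r, Subtype.ext (Real.exp_log r.2).symm⟩
    obtain ⟨a, ρ, rfl⟩ : ∃ (a : TangentSpace I x) (ρ : ℝ),
        v = coneVec ((x, expPos t) : Cone M) a ρ :=
      ⟨_, _, (coneVec_dproj_dr v).symm⟩
    rw [dproj_coneVec, dr_coneVec, coneVec_add_radial, map_add, map_add, map_add,
      hJ.dr_radial, add_zero]
    refine ⟨congrArg₂ (fun a b : E ↦ a + b) (hJ.rayProj_horizontal x a t)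
      (hJ.rayProj_radial x ρ t), (hJ.rayDr_horizontal x a t).trans ?_⟩
    have e : rayDr J x a 0 0 = -(η x a) := (neg_neg _).symm
    exact (congrArg (fun c ↦ Real.exp t * c) e).trans (mul_neg _ _)

end ConeMetric

/-! ### Almost contact metric structures -/

section BilinearAlgebra

variable {V : Type*} [AddCommGroup V] [Module ℝ V] [TopologicalSpace V]

lemma bilin_add_left [IsTopologicalAddGroup V] [ContinuousSMul ℝ V] (S : V →L[ℝ] V →L[ℝ] V)
    (u u' v : V) : S (u + u') v = S u v + S u' v := by
  rw [map_add, add_apply]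

lemma bilin_smul_left [IsTopologicalAddGroup V] [ContinuousSMul ℝ V] (S : V →L[ℝ] V →L[ℝ] V)
    (c : ℝ) (u v : V) : S (c • u) v = c • S u v := by
  rw [map_smul, smul_apply]

lemma bilin_zero_left [IsTopologicalAddGroup V] [ContinuousSMul ℝ V] (S : V →L[ℝ] V →L[ℝ] V)
    (v : V) : S 0 v = 0 := by
  rw [map_zero, zero_apply]

end BilinearAlgebra

section AlmostContact

variable {E : Type*} [NormedAddCommGroup E] [NormedSpace ℝ E]
  {H : Type*} [TopologicalSpace H] {I : ModelWithCorners ℝ E H}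
  {M : Type*} [TopologicalSpace M] [ChartedSpace H M] [IsManifold I ∞ M]
  {g : ContMDiffRiemannianMetric I ∞ E (fun y : M ↦ TangentSpace I y)}
  {S : ContactTriple I M}
  {J : Π p : Cone M, TangentSpace (coneModel I) p →L[ℝ] TangentSpace (coneModel I) p}

namespace IsAlmostContactMetric

lemma xi_ne_zero (h : IsAlmostContactMetric g S) (x : M) : S.ξ x ≠ 0 := by
  intro h0
  have := h.eta_xi x
  rw [h0, map_zero] at this
  exact zero_ne_one this

lemma phi_xi (h : IsAlmostContactMetric g S) (x : M) : S.Φ x (S.ξ x) = 0 := by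
  have h1 : S.Φ x (S.Φ x (S.ξ x)) = 0 := by
    rw [h.phi_sq, h.eta_xi, one_smul, neg_add_cancel]
  have h2 := h.phi_sq x (S.Φ x (S.ξ x))
  rw [h1, map_zero] at h2
  have h3 : S.Φ x (S.ξ x) = S.η x (S.Φ x (S.ξ x)) • S.ξ x := (neg_add_eq_zero.1 h2.symm)
  have h4 : S.η x (S.Φ x (S.ξ x)) • S.η x (S.Φ x (S.ξ x)) • S.ξ x = 0 := by
    rw [← h3, ← map_smul, ← h3, h1]
  rw [smul_smul, smul_eq_zero, or_iff_left (h.xi_ne_zero x), mul_self_eq_zero] at h4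
  rw [h3, h4, zero_smul]

lemma eta_phi (h : IsAlmostContactMetric g S) (x : M) (u : TangentSpace I x) :
    S.η x (S.Φ x u) = 0 := by
  have h1 := h.phi_sq x (S.Φ x u)
  rw [h.phi_sq x u, map_add, map_neg, map_smul, h.phi_xi, smul_zero, add_zero] at h1
  have h2 := left_eq_add.1 h1
  rwa [smul_eq_zero, or_iff_left (h.xi_ne_zero x)] at h2

lemma inner_xi (h : IsAlmostContactMetric g S) (x : M) (u : TangentSpace I x) :
    g.inner x (S.ξ x) u = S.η x u := by
  have h1 := h.metric x (S.ξ x) u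
  rw [h.phi_xi, form_zero_left, h.eta_xi, one_mul] at h1
  linarith

lemma inner_phi_left (h : IsAlmostContactMetric g S) (x : M) (u v : TangentSpace I x) :
    g.inner x (S.Φ x u) v = -g.inner x u (S.Φ x v) := by
  have h1 := h.metric x (S.Φ x u) v
  rw [h.phi_sq, form_add_left, form_neg_left, form_smul_left, h.inner_xi, h.eta_phi,
    h.eta_phi] at h1
  linarith

lemma fundamentalForm_skew (h : IsAlmostContactMetric g S) (x : M) (u v : TangentSpace I x) :
    fundamentalForm I g.inner S.Φ x u v = -fundamentalForm I g.inner S.Φ x v u := by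
  change g.inner x (S.Φ x u) v = -g.inner x (S.Φ x v) u
  rw [h.inner_phi_left, g.symm]

lemma fundamentalForm_phi (h : IsAlmostContactMetric g S) (x : M) (u v : TangentSpace I x) :
    fundamentalForm I g.inner S.Φ x (S.Φ x u) (S.Φ x v) = fundamentalForm I g.inner S.Φ x u v := by
  change g.inner x (S.Φ x (S.Φ x u)) (S.Φ x v) = g.inner x (S.Φ x u) v
  rw [h.metric, h.eta_phi]
  ring

end IsAlmostContactMetric

lemma InducesOnCone.dproj_apply (hJ : InducesOnCone S J) {p : Cone M}
    (v : TangentSpace (coneModel I) p) :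
    dproj I p (J p v) = S.Φ p.1 (dproj I p v) + (dr I p v / radius p) • S.ξ p.1 := (hJ p v).1

lemma InducesOnCone.dr_apply (hJ : InducesOnCone S J) {p : Cone M}
    (v : TangentSpace (coneModel I) p) :
    dr I p (J p v) = -(radius p * S.η p.1 (dproj I p v)) := (hJ p v).2

lemma InducesOnCone.hermitian_iff (hJ : InducesOnCone S J) :
    ((∀ p v, J p (J p v) = -v) ∧
      ∀ p v w, coneMetric I g.inner p (J p v) (J p w) = coneMetric I g.inner p v w) ↔
      IsAlmostContactMetric g S := by
  constructor
  · rintro ⟨hsq, hher⟩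
    have eta_xi : ∀ p : Cone M, S.η p.1 (S.ξ p.1) = 1 := fun p ↦ by
      have h := congrArg (dr I p) (hsq p (coneVec p 0 1))
      have hr := (radius_pos p).ne'
      rw [hJ.dr_apply, hJ.dproj_apply, map_neg, dproj_coneVec, dr_coneVec, map_zero, zero_add,
        map_smul, smul_eq_mul] at h
      field_simp at h
      exact neg_injective h
    have phi_sq : ∀ (p : Cone M) (u : TangentSpace I p.1),
        S.Φ p.1 (S.Φ p.1 u) = -u + S.η p.1 u • S.ξ p.1 := fun p u ↦ by
      have h := congrArg (dproj I p) (hsq p (coneVec p u 0))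
      rw [hJ.dproj_apply, hJ.dproj_apply, hJ.dr_apply, map_neg, dproj_coneVec, dr_coneVec,
        zero_div, zero_smul, add_zero, neg_div, mul_div_cancel_left₀ _ (radius_pos p).ne',
        neg_smul] at h
      exact eq_add_of_add_neg_eq h
    have metric : ∀ (p : Cone M) (u v : TangentSpace I p.1),
        g.inner p.1 (S.Φ p.1 u) (S.Φ p.1 v) = g.inner p.1 u v - S.η p.1 u * S.η p.1 v :=
      fun p u v ↦ by
      have h := hher p (coneVec p u 0) (coneVec p v 0)
      have hr := pow_pos (radius_pos p) 2
      rw [coneMetric_apply, coneMetric_apply, hJ.dproj_apply, hJ.dproj_apply, hJ.dr_apply,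
        hJ.dr_apply] at h
      simp only [dproj_coneVec, dr_coneVec, zero_div, zero_smul, add_zero,
        zero_mul, zero_add] at h
      refine mul_left_cancel₀ hr.ne' ?_
      linear_combination h
    exact ⟨fun x ↦ eta_xi (unitPoint x), fun x ↦ phi_sq (unitPoint x),
      fun x ↦ metric (unitPoint x)⟩
  · intro h
    refine ⟨fun p v ↦ cone_ext ?_ ?_, fun p v w ↦ ?_⟩
    · rw [hJ.dproj_apply, hJ.dproj_apply, hJ.dr_apply, map_add, map_smul, h.phi_xi, smul_zero,
        add_zero, h.phi_sq, map_neg, neg_div, mul_div_cancel_left₀ _ (radius_pos p).ne', neg_smul,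
        add_assoc, add_neg_cancel, add_zero]
    · rw [hJ.dr_apply, hJ.dproj_apply, map_add, h.eta_phi, map_smul, h.eta_xi, zero_add, map_neg,
        smul_eq_mul, mul_one, mul_div_cancel₀ _ (radius_pos p).ne']
    · rw [coneMetric_apply, coneMetric_apply]
      have hr := (radius_pos p).ne'
      have h₁ := h.inner_xi p.1 (S.Φ p.1 (dproj I p w))
      have h₂ := h.inner_xi p.1 (S.Φ p.1 (dproj I p v))
      rw [h.eta_phi] at h₁ h₂
      rw [hJ.dr_apply, hJ.dr_apply, hJ.dproj_apply, hJ.dproj_apply, form_add_left, form_smul_left,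
        map_add (g.inner p.1 _), map_add (g.inner p.1 _), map_smul (g.inner p.1 _),
        map_smul (g.inner p.1 _), h.metric, h₁, g.symm p.1 _ (S.ξ p.1), h₂, h.inner_xi, h.eta_xi,
        smul_eq_mul, smul_eq_mul]
      field_simp
      ring

/-- The exterior derivative of a 1-form as a tensor, in the chart centred at `x`. -/
def dOne (η : Π y : M, TangentSpace I y →L[ℝ] ℝ) (x : M) (u v : TangentSpace I x) : ℝ :=
  dCovec I η x u v - dCovec I η x v u

namespace IsAlmostContactMetric

lemma dCovec_xi (h : IsAlmostContactMetric g S) (x : M) (u : TangentSpace I x) :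
    dCovec I S.η x u (S.ξ x) = -S.η x (dVec I S.ξ x u) := by
  have hη := S.diffCovecAt_eta x
  have e1 := hη.mvfderiv_apply (S.diffAt_xi x) u
  rw [funext h.eta_xi, mvfderiv_const, zero_apply] at e1
  exact eq_neg_of_add_eq_zero_left e1.symm

lemma dEnd_xi (h : IsAlmostContactMetric g S) (x : M) (u : TangentSpace I x) :
    dEnd I S.Φ x u (S.ξ x) = -S.Φ x (dVec I S.ξ x u) := by
  have hΦ := S.smooth_Φ.diffEndAt x
  have e1 := hΦ.dVec_apply (S.diffAt_xi x) u
  have e : (fun y ↦ S.Φ y (S.ξ y)) = (fun _ : M ↦ (0 : ℝ)) • S.ξ := by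
    funext y
    simp [h.phi_xi]
  rw [e, dVec_smul mdifferentiableAt_const (S.diffAt_xi x), mvfderiv_const, zero_apply,
    zero_smul, zero_smul, add_zero] at e1
  exact eq_neg_of_add_eq_zero_left e1.symm

lemma dCovec_phi (h : IsAlmostContactMetric g S) (x : M) (u v : TangentSpace I x) :
    dCovec I S.η x u (S.Φ x v) = -S.η x (dEnd I S.Φ x u v) := by
  have hΦ := S.smooth_Φ.diffEndAt x
  have hη := S.diffCovecAt_eta x
  have hv := diffAt_constVec I x v
  have e1 := hη.mvfderiv_apply (hΦ.diffAt_apply hv) u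
  have e : (fun y ↦ S.η y (S.Φ y (constVec I x v y))) = fun _ ↦ (0 : ℝ) :=
    funext fun y ↦ h.eta_phi y _
  rw [e, mvfderiv_const, zero_apply, hΦ.dVec_apply hv, dVec_constVec, zero_apply, map_zero,
    add_zero, constVec_self] at e1
  exact eq_neg_of_add_eq_zero_left e1.symm

lemma dForm_xi (h : IsAlmostContactMetric g S) (x : M) (u v : TangentSpace I x) :
    dForm I g.inner x u (S.ξ x) v = dCovec I S.η x u v - g.inner x (dVec I S.ξ x u) v := by
  have hη := S.diffCovecAt_eta x
  have hv := diffAt_constVec I x v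
  have e1 := (diffFormAt_metric g x).mvfderiv_apply (S.diffAt_xi x) hv u
  have e : (fun y ↦ g.inner y (S.ξ y) (constVec I x v y)) = fun y ↦ S.η y (constVec I x v y) :=
    funext fun y ↦ h.inner_xi y _
  rw [e, hη.mvfderiv_apply hv, dVec_constVec, zero_apply, map_zero, map_zero, add_zero, add_zero,
    constVec_self] at e1
  linarith

end IsAlmostContactMetric

end AlmostContact

/-! ### The Nijenhuis tensor and the fundamental form of the cone -/

section ConeNijenhuis
variable {E : Type*} [NormedAddCommGroup E] [NormedSpace ℝ E]
  {H : Type*} [TopologicalSpace H] {I : ModelWithCorners ℝ E H}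
  {M : Type*} [TopologicalSpace M] [ChartedSpace H M] [IsManifold I ∞ M]
  {g : ContMDiffRiemannianMetric I ∞ E (fun y : M ↦ TangentSpace I y)}
  {S : ContactTriple I M}
  {J : Π p : Cone M, TangentSpace (coneModel I) p →L[ℝ] TangentSpace (coneModel I) p}

/-- The endomorphism field of the cone determined by `J(r ∂_r) = ξ`, `J X = Φ X - r η(X) ∂_r`. -/
def coneEndo (S : ContactTriple I M) (p : Cone M) :
    TangentSpace (coneModel I) p →L[ℝ] TangentSpace (coneModel I) p :=
  (liftL p).comp ((S.Φ p.1).comp (dproj I p) +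
      (radius p)⁻¹ • (dr I p).smulRight (S.ξ p.1)) -
    radius p • ((S.η p.1).comp (dproj I p)).smulRight (coneVec p 0 1)

lemma inducesOnCone_coneEndo (S : ContactTriple I M) : InducesOnCone S (coneEndo S) := by
  intro p v
  have e : coneEndo S p v =
      coneVec p (S.Φ p.1 (dproj I p v) + (radius p)⁻¹ • dr I p v • S.ξ p.1) 0
      - radius p • S.η p.1 (dproj I p v) • coneVec p 0 1 := rfl
  rw [e, map_sub, map_sub, dproj_coneVec, dr_coneVec, map_smul, map_smul, map_smul, map_smul,
    dproj_coneVec, dr_coneVec]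
  refine ⟨?_, ?_⟩
  · rw [smul_zero, smul_zero, sub_zero, smul_smul, div_eq_inv_mul]
  · simp

/-- The normality tensor `N_Φ + dη ⊗ ξ`. -/
def normality (S : ContactTriple I M) (x : M) (u v : TangentSpace I x) : TangentSpace I x :=
  nijenhuisAt S.Φ x u v + dOne S.η x u v • S.ξ x

/-- The Lie derivative `(L_ξ Φ) u`. -/
def lieXiPhi (S : ContactTriple I M) (x : M) (u : TangentSpace I x) : TangentSpace I x :=
  dEnd I S.Φ x (S.ξ x) u - dVec I S.ξ x (S.Φ x u) + S.Φ x (dVec I S.ξ x u)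

/-- The Lie derivative `(L_ξ η) u`. -/
def lieXiEta (S : ContactTriple I M) (x : M) (u : TangentSpace I x) : ℝ :=
  dCovec I S.η x (S.ξ x) u + S.η x (dVec I S.ξ x u)

/-- The tensor `(L_{Φu} η) v - (L_{Φv} η) u` of an almost contact structure. -/
def liePhiEta (S : ContactTriple I M) (x : M) (u v : TangentSpace I x) : ℝ :=
  dCovec I S.η x (S.Φ x u) v - dCovec I S.η x (S.Φ x v) u - S.η x (dEnd I S.Φ x u v)
    + S.η x (dEnd I S.Φ x v u)

lemma InducesOnCone.dproj_nijenhuisAt (hJ : InducesOnCone S J) (p : Cone M)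
    (u v : TangentSpace (coneModel I) p) :
    dproj I p (nijenhuisAt J p u v) = normality S p.1 (dproj I p u) (dproj I p v)
      + ((dr I p u / radius p) • lieXiPhi S p.1 (dproj I p v)
        - (dr I p v / radius p) • lieXiPhi S p.1 (dproj I p u)) := by
  have hr := (radius_pos p).ne'
  unfold nijenhuisAt normality lieXiPhi nijenhuisAt dOne
  simp only [map_add (dproj I p), map_sub (dproj I p), hJ.dproj_dEnd, hJ.dproj_apply,
    hJ.dr_apply, hJ.dr_dEnd, bilin_add_left, bilin_smul_left, map_add (S.Φ p.1),
    map_sub (S.Φ p.1), map_smul (S.Φ p.1), map_add (dVec I S.ξ p.1), map_smul (dVec I S.ξ p.1)]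
  match_scalars <;> field_simp <;> ring

lemma InducesOnCone.dr_nijenhuisAt (hJ : InducesOnCone S J) (p : Cone M)
    (u v : TangentSpace (coneModel I) p) :
    dr I p (nijenhuisAt J p u v) = -radius p * liePhiEta S p.1 (dproj I p u) (dproj I p v)
      - dr I p u * lieXiEta S p.1 (dproj I p v) + dr I p v * lieXiEta S p.1 (dproj I p u) := by
  have hr := (radius_pos p).ne'
  unfold nijenhuisAt liePhiEta lieXiEta
  simp only [map_add (dr I p), map_sub (dr I p), hJ.dproj_dEnd, hJ.dproj_apply,
    hJ.dr_apply, hJ.dr_dEnd, form_add_left, form_smul_left, map_add (S.η p.1),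
    map_sub (S.η p.1), map_smul (S.η p.1), smul_eq_mul]
  field_simp
  ring

/-- Normality forces the remaining components of the Nijenhuis tensor of the cone to vanish, and
makes `dη` invariant under `Φ`. -/
lemma IsAlmostContactMetric.normality_consequences (h : IsAlmostContactMetric g S) {x : M}
    (hN : ∀ u v, normality S x u v = 0) :
    (∀ u, lieXiPhi S x u = 0) ∧ (∀ u, lieXiEta S x u = 0) ∧ (∀ u v, liePhiEta S x u v = 0) ∧
    ∀ u v, dOne S.η x (S.Φ x u) (S.Φ x v) = dOne S.η x u v := by
  have h₁ : ∀ u, S.Φ x (lieXiPhi S x u) - lieXiEta S x u • S.ξ x = 0 := by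
    intro u
    have k := hN u (S.ξ x)
    unfold normality nijenhuisAt dOne at k
    rw [h.phi_xi, bilin_zero_left, h.dEnd_xi, h.dEnd_xi, h.dCovec_xi, map_neg] at k
    unfold lieXiPhi lieXiEta
    rw [map_add, map_sub, ← k]
    module
  have h₂ : ∀ u, lieXiEta S x u = 0 := by
    intro u
    have k := congrArg (S.η x) (h₁ u)
    rw [map_sub, h.eta_phi, map_smul, h.eta_xi, smul_eq_mul, mul_one, zero_sub, map_zero] at k
    exact neg_eq_zero.1 k
  have h₃ : ∀ u, dCovec I S.η x (S.ξ x) u = -S.η x (dVec I S.ξ x u) :=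
    fun u ↦ eq_neg_of_add_eq_zero_left (h₂ u)
  have h₄ : ∀ u v, dOne S.η x (S.Φ x u) (S.Φ x v) = dOne S.η x u v := by
    intro u v
    have k := congrArg (S.η x) (hN u v)
    unfold normality nijenhuisAt at k
    simp only [map_add, map_sub, map_smul, h.eta_phi, h.eta_xi, map_zero, smul_eq_mul, mul_one,
      sub_zero, add_zero] at k
    have k₁ := h.dCovec_phi x (S.Φ x u) v
    have k₂ := h.dCovec_phi x (S.Φ x v) u
    unfold dOne at k ⊢
    linarith
  refine ⟨fun u ↦ ?_, h₂, fun u v ↦ ?_, h₄⟩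
  · have k := h₁ u
    rw [h₂, zero_smul, sub_zero] at k
    have k₂ := h.phi_sq x (lieXiPhi S x u)
    rw [k, map_zero] at k₂
    have k₃ : S.η x (lieXiPhi S x u) = 0 := by
      unfold lieXiPhi
      rw [map_add, map_sub, h.eta_phi, add_zero]
      have a₁ := h.dCovec_phi x (S.ξ x) u
      have a₂ := h₃ (S.Φ x u)
      linarith
    rw [k₃, zero_smul, add_zero] at k₂
    exact neg_eq_zero.1 k₂.symm
  · have k := h₄ (S.Φ x u) v
    rw [h.phi_sq] at k
    have a₁ := h.dCovec_phi x u v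
    have a₂ := h.dCovec_phi x v u
    have a₃ := h₃ (S.Φ x v)
    have a₄ := h.dCovec_xi x (S.Φ x v)
    unfold dOne at k
    rw [form_add_left, form_neg_left, form_smul_left, map_add, map_neg, map_smul, smul_eq_mul,
      a₃, a₄] at k
    unfold liePhiEta
    linarith

lemma InducesOnCone.nijenhuisAt_eq_zero_iff (hJ : InducesOnCone S J)
    (h : IsAlmostContactMetric g S) :
    (∀ p u v, nijenhuisAt J p u v = 0) ↔ ∀ x u v, normality S x u v = 0 := by
  constructor
  · intro hN
    have key : ∀ (p : Cone M) (u v : TangentSpace I p.1), normality S p.1 u v = 0 := by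
      intro p u v
      have k := hJ.dproj_nijenhuisAt p (coneVec p u 0) (coneVec p v 0)
      rw [hN, map_zero] at k
      simpa only [dproj_coneVec, dr_coneVec, zero_div, zero_smul, sub_zero, add_zero] using k.symm
    exact fun x ↦ key (unitPoint x)
  · intro hN p u v
    obtain ⟨h₁, h₂, h₃, -⟩ := h.normality_consequences (hN p.1)
    refine cone_ext ?_ ?_
    · rw [hJ.dproj_nijenhuisAt, hN, h₁, h₁, smul_zero, smul_zero, sub_zero, add_zero, map_zero]
    · rw [hJ.dr_nijenhuisAt, h₂, h₂, h₃, map_zero]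
      ring

/-- The 2-form `2 ω - dη`. -/
def thetaAt (g : ContMDiffRiemannianMetric I ∞ E (fun y : M ↦ TangentSpace I y))
    (S : ContactTriple I M) (x : M) (u v : TangentSpace I x) : ℝ :=
  2 * fundamentalForm I g.inner S.Φ x u v - dOne S.η x u v

lemma InducesOnCone.dForm_cone (hJ : InducesOnCone S J) (h : IsAlmostContactMetric g S)
    (p : Cone M) (u v w : TangentSpace (coneModel I) p) :
    dForm (coneModel I) (fundamentalForm (coneModel I) (coneMetric I g.inner) J) p u v w =
      2 * radius p * dr I p u * fundamentalForm I g.inner S.Φ p.1 (dproj I p v) (dproj I p w)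
      + radius p ^ 2 * dForm I (fundamentalForm I g.inner S.Φ) p.1 (dproj I p u) (dproj I p v)
          (dproj I p w)
      + dr I p u * (dr I p v * S.η p.1 (dproj I p w) - dr I p w * S.η p.1 (dproj I p v))
      + radius p * (dr I p v * dCovec I S.η p.1 (dproj I p u) (dproj I p w)
        - dr I p w * dCovec I S.η p.1 (dproj I p u) (dproj I p v)) := by
  have hr := (radius_pos p).ne'
  have e : fundamentalForm I g.inner S.Φ p.1 (dproj I p v) (dproj I p w)
    = g.inner p.1 (S.Φ p.1 (dproj I p v)) (dproj I p w) := rfl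
  rw [dForm_fundamentalForm (diffFormAt_coneMetric g p) (hJ.smoothEndo.diffEndAt p),
    dForm_fundamentalForm (diffFormAt_metric g p.1) (S.smooth_Φ.diffEndAt p.1),
    dForm_coneMetric (diffFormAt_metric g p.1), coneMetric_apply, hJ.dproj_dEnd, hJ.dr_dEnd,
    hJ.dproj_apply, e]
  rw [tri_add₂, tri_smul₂, form_add_left, form_add_left, form_sub_left, form_smul_left,
    form_smul_left, form_smul_left, h.inner_xi, h.dForm_xi]
  field_simp
  ring

/-- `dΩ = r dr ∧ (2 ω - dη) + r² dω` for the fundamental form `Ω` of the cone. -/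
lemma InducesOnCone.dTwo_cone (hJ : InducesOnCone S J) (h : IsAlmostContactMetric g S)
    (p : Cone M) (u v w : TangentSpace (coneModel I) p) :
    dTwo (fundamentalForm (coneModel I) (coneMetric I g.inner) J) p u v w =
      radius p * (dr I p u * thetaAt g S p.1 (dproj I p v) (dproj I p w)
        - dr I p v * thetaAt g S p.1 (dproj I p u) (dproj I p w)
        + dr I p w * thetaAt g S p.1 (dproj I p u) (dproj I p v))
      + radius p ^ 2 * dTwo (fundamentalForm I g.inner S.Φ) p.1 (dproj I p u) (dproj I p v)
          (dproj I p w) := by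
  unfold dTwo thetaAt dOne
  rw [hJ.dForm_cone h, hJ.dForm_cone h, hJ.dForm_cone h]
  ring

end ConeNijenhuis

/-! ### The torsion equation on the base -/

section TwoForms
variable {E : Type*} [NormedAddCommGroup E] [NormedSpace ℝ E]
  {H : Type*} [TopologicalSpace H] {I : ModelWithCorners ℝ E H}
  {M : Type*} [TopologicalSpace M] [ChartedSpace H M] [IsManifold I ∞ M]
  {β : Π y : M, TangentSpace I y →L[ℝ] TangentSpace I y →L[ℝ] ℝ} {x : M}

lemma dTwo_swap₁₂ (hβ : DiffFormAt I β x) (hs : ∀ y u v, β y u v = -β y v u)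
    (u v w : TangentSpace I x) : dTwo β x u v w = -dTwo β x v u w := by
  unfold dTwo
  linarith [dForm_skew hβ hs w u v]

lemma dTwo_swap₂₃ (hβ : DiffFormAt I β x) (hs : ∀ y u v, β y u v = -β y v u)
    (u v w : TangentSpace I x) : dTwo β x u v w = -dTwo β x u w v := by
  unfold dTwo
  linarith [dForm_skew hβ hs u v w]

lemma dTwo_add_smul (a ξ v w : TangentSpace I x) (c : ℝ) :
    dTwo β x (a + c • ξ) v w = dTwo β x a v w + c * dTwo β x ξ v w := by
  unfold dTwo
  rw [tri_add₁, tri_add₂, tri_add₂, tri_smul₁, tri_smul₂, tri_smul₂]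
  ring

/-- Contracting to zero with `ξ`, a 3-form does not see multiples of `ξ`. -/
lemma dTwo_add_smul_of_contract (hβ : DiffFormAt I β x) (hs : ∀ y u v, β y u v = -β y v u)
    {ξ : TangentSpace I x} (hξ : ∀ v w, dTwo β x ξ v w = 0) (a b c : TangentSpace I x)
    (ρ σ τ : ℝ) : dTwo β x (a + ρ • ξ) (b + σ • ξ) (c + τ • ξ) = dTwo β x a b c := by
  have h₁ : ∀ a b c ρ, dTwo β x (a + ρ • ξ) b c = dTwo β x a b c := fun a b c ρ ↦ by
    rw [dTwo_add_smul, hξ, mul_zero, add_zero]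
  rw [h₁, dTwo_swap₁₂ hβ hs, h₁, dTwo_swap₁₂ hβ hs, neg_neg, dTwo_swap₂₃ hβ hs,
    dTwo_swap₁₂ hβ hs a, h₁, ← dTwo_swap₁₂ hβ hs, ← dTwo_swap₂₃ hβ hs]

lemma dTwo_zero_left (v w : TangentSpace I x) : dTwo β x 0 v w = 0 := by
  unfold dTwo
  rw [tri_zero₁, tri_zero₂, tri_zero₂]
  ring

end TwoForms

section TorsionEquation
variable {E : Type*} [NormedAddCommGroup E] [NormedSpace ℝ E]
  {H : Type*} [TopologicalSpace H] {I : ModelWithCorners ℝ E H}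
  {M : Type*} [TopologicalSpace M] [ChartedSpace H M] [IsManifold I ∞ M]
  {g : ContMDiffRiemannianMetric I ∞ E (fun y : M ↦ TangentSpace I y)}
  {T : ThreeForm I M} {S : ContactTriple I M}
  {J : Π p : Cone M, TangentSpace (coneModel I) p →L[ℝ] TangentSpace (coneModel I) p}

lemma thetaAt_swap (h : IsAlmostContactMetric g S) (x : M) (u v : TangentSpace I x) :
    thetaAt g S x u v = -thetaAt g S x v u := by
  unfold thetaAt dOne
  linarith [h.fundamentalForm_skew x u v]

lemma thetaAt_add_smul (x : M) (u ξ v : TangentSpace I x) (c : ℝ) :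
    thetaAt g S x (u + c • ξ) v = thetaAt g S x u v + c * thetaAt g S x ξ v := by
  unfold thetaAt dOne
  rw [form_add_left, form_smul_left, form_add_left, form_smul_left, map_add, map_smul, smul_eq_mul]
  ring

lemma thetaAt_zero_left (x : M) (v : TangentSpace I x) : thetaAt g S x 0 v = 0 := by
  unfold thetaAt dOne
  rw [form_zero_left, form_zero_left, map_zero]
  ring

lemma thetaAt_phi (h : IsAlmostContactMetric g S) {x : M} (hN : ∀ u v, normality S x u v = 0)
    (u v : TangentSpace I x) : thetaAt g S x (S.Φ x u) (S.Φ x v) = thetaAt g S x u v := by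
  unfold thetaAt
  rw [h.fundamentalForm_phi, (h.normality_consequences hN).2.2.2]

/-- The equation `r² T = dΩ(J·, J·, J·)` on the cone, written on `M`. -/
def TorsionEquation (g : ContMDiffRiemannianMetric I ∞ E (fun y : M ↦ TangentSpace I y))
    (T : ThreeForm I M) (S : ContactTriple I M) (x : M) : Prop :=
  ∀ (a b c : TangentSpace I x) (ρ σ τ : ℝ), T.toFun x a b c =
    dTwo (fundamentalForm I g.inner S.Φ) x (S.Φ x a + ρ • S.ξ x) (S.Φ x b + σ • S.ξ x)
        (S.Φ x c + τ • S.ξ x)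
      - (S.η x a * thetaAt g S x (S.Φ x b + σ • S.ξ x) (S.Φ x c + τ • S.ξ x)
        - S.η x b * thetaAt g S x (S.Φ x a + ρ • S.ξ x) (S.Φ x c + τ • S.ξ x)
        + S.η x c * thetaAt g S x (S.Φ x a + ρ • S.ξ x) (S.Φ x b + σ • S.ξ x))

lemma InducesOnCone.torsion_eq_iff (hJ : InducesOnCone S J) (h : IsAlmostContactMetric g S) :
    (∀ p u v w, coneTorsion I T.toFun p u v w =
      dTwo (fundamentalForm (coneModel I) (coneMetric I g.inner) J) p (J p u) (J p v) (J p w)) ↔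
    ∀ x, TorsionEquation g T S x := by
  constructor
  · intro hK
    have key : ∀ p : Cone M, TorsionEquation g T S p.1 := by
      intro p a b c ρ σ τ
      have hr := (radius_pos p).ne'
      have k := hK p (coneVec p a (radius p * ρ)) (coneVec p b (radius p * σ))
        (coneVec p c (radius p * τ))
      rw [coneTorsion_apply, hJ.dTwo_cone h] at k
      simp only [hJ.dproj_apply, hJ.dr_apply, dproj_coneVec, dr_coneVec,
        mul_div_cancel_left₀ _ hr] at k
      refine mul_left_cancel₀ (pow_ne_zero 2 hr) ?_
      linear_combination k
    exact fun x ↦ key (unitPoint x)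
  · intro hK p u v w
    rw [coneTorsion_apply, hJ.dTwo_cone h, hJ.dproj_apply, hJ.dproj_apply, hJ.dproj_apply,
      hJ.dr_apply, hJ.dr_apply, hJ.dr_apply, hK p.1 _ _ _ (dr I p u / radius p)
        (dr I p v / radius p) (dr I p w / radius p)]
    ring

lemma diffFormAt_fundamentalForm
    (g : ContMDiffRiemannianMetric I ∞ E (fun y : M ↦ TangentSpace I y))
    (S : ContactTriple I M) (x : M) : DiffFormAt I (fundamentalForm I g.inner S.Φ) x :=
  (diffFormAt_metric g x).fundamentalForm (S.smooth_Φ.diffEndAt x)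

/-- On a normal almost contact metric manifold the torsion equation splits into its components
along `ξ` and along the contact distribution. -/
theorem torsionEquation_iff (h : IsAlmostContactMetric g S) {x : M}
    (hN : ∀ u v, normality S x u v = 0) :
    TorsionEquation g T S x ↔
      (∀ u v, T.toFun x (S.ξ x) u v = -thetaAt g S x u v) ∧
      (∀ u v, dTwo (fundamentalForm I g.inner S.Φ) x (S.ξ x) u v = 0) ∧
      ∀ u v w, S.η x u = 0 → S.η x v = 0 → S.η x w = 0 → T.toFun x u v w =
        dTwo (fundamentalForm I g.inner S.Φ) x (S.Φ x u) (S.Φ x v) (S.Φ x w) := by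
  have hd := diffFormAt_fundamentalForm g S x
  have hs := h.fundamentalForm_skew
  have hT := T.skew
  constructor
  · intro hK
    have hc : ∀ u v, dTwo (fundamentalForm I g.inner S.Φ) x (S.ξ x) u v = 0 := by
      intro u v
      have e : ∀ y, S.Φ x (-S.Φ x y) + S.η x y • S.ξ x = y := fun y ↦ by
        rw [map_neg, h.phi_sq, neg_add, neg_neg, neg_add_cancel_right]
      -- `J` maps `r ∂_r` to `ξ`, and every vector `y` is of the form `Φ b + σ ξ` with `η b = 0`.
      have k := hK 0 (-S.Φ x u) (-S.Φ x v) 1 (S.η x u) (S.η x v)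
      rw [e, e, map_zero (S.Φ x), map_zero (S.η x), map_neg (S.η x), map_neg (S.η x),
        h.eta_phi, h.eta_phi, tri_zero₁, zero_add, one_smul] at k
      linarith
    refine ⟨fun u v ↦ ?_, hc, fun u v w hu hv hw ↦ ?_⟩
    · have k := hK (S.ξ x) u v 0 0 0
      simp only [zero_smul, add_zero] at k
      rw [h.phi_xi, h.eta_xi, dTwo_zero_left, thetaAt_zero_left, thetaAt_zero_left,
        thetaAt_phi h hN] at k
      linarith
    · have k := hK u v w 0 0 0
      simp only [zero_smul, add_zero] at k
      rw [hu, hv, hw] at k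
      linarith
  · rintro ⟨hξ, hc, hD⟩ a b c ρ σ τ
    have hθ : ∀ v, thetaAt g S x (S.ξ x) v = 0 := fun v ↦ by
      have k₁ := hξ (S.ξ x) v
      have k₂ := hT.1 x (S.ξ x) (S.ξ x) v
      linarith
    have hθ' : ∀ u v ρ σ, thetaAt g S x (S.Φ x u + ρ • S.ξ x) (S.Φ x v + σ • S.ξ x)
        = -T.toFun x (S.ξ x) u v := fun u v ρ σ ↦ by
      rw [thetaAt_add_smul, hθ, thetaAt_swap h, thetaAt_add_smul, hθ, mul_zero, mul_zero,
        add_zero, add_zero, ← thetaAt_swap h, thetaAt_phi h hN, hξ, neg_neg]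
    rw [dTwo_add_smul_of_contract hd hs hc, hθ', hθ', hθ']
    have hη : ∀ y, S.η x (y - S.η x y • S.ξ x) = 0 := fun y ↦ by
      rw [map_sub, map_smul, h.eta_xi, smul_eq_mul, mul_one, sub_self]
    have hΦ : ∀ y, S.Φ x (y - S.η x y • S.ξ x) = S.Φ x y := fun y ↦ by
      rw [map_sub, map_smul, h.phi_xi, smul_zero, sub_zero]
    -- Evaluate on the projections of `a`, `b`, `c` to the contact distribution.
    have k := hD _ _ _ (hη a) (hη b) (hη c)
    rw [hΦ, hΦ, hΦ] at k
    rw [← k]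
    simp only [sub_eq_add_neg, ← neg_smul, tri_add₁, tri_add₂, tri_add₃, tri_smul₁, tri_smul₂,
      tri_smul₃]
    have t : ∀ w, T.toFun x (S.ξ x) (S.ξ x) w = 0 := fun w ↦ by linarith [hT.1 x (S.ξ x) (S.ξ x) w]
    have t₂ : ∀ w, T.toFun x (S.ξ x) w (S.ξ x) = 0 := fun w ↦ by
      linarith [hT.2 x (S.ξ x) (S.ξ x) w, t w]
    have t₃ : ∀ w, T.toFun x w (S.ξ x) (S.ξ x) = 0 := fun w ↦ by
      linarith [hT.1 x (S.ξ x) w (S.ξ x), t₂ w]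
    simp only [t, t₂, t₃]
    linear_combination (S.η x b) * hT.1 x a (S.ξ x) c + S.η x c * hT.2 x a b (S.ξ x)
      - S.η x c * hT.1 x a (S.ξ x) b

end TorsionEquation

/-! ### The correspondence -/

section Correspondence
variable {E : Type*} [NormedAddCommGroup E] [NormedSpace ℝ E] [FiniteDimensional ℝ E]
  {H : Type*} [TopologicalSpace H] {I : ModelWithCorners ℝ E H}
  {M : Type*} [TopologicalSpace M] [ChartedSpace H M] [IsManifold I ∞ M]
  {g : ContMDiffRiemannianMetric I ∞ E (fun y : M ↦ TangentSpace I y)}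
  {T : ThreeForm I M} {S : ContactTriple I M}
  {J : Π p : Cone M, TangentSpace (coneModel I) p →L[ℝ] TangentSpace (coneModel I) p}

lemma extDerivOne_eta (S : ContactTriple I M) {x : M} {X Y : Π y : M, TangentSpace I y}
    (hX : DiffAt I X x) (hY : DiffAt I Y x) :
    extDerivOne I S.η X Y x = dOne S.η x (X x) (Y x) :=
  have : CompleteSpace E := FiniteDimensional.complete ℝ E
  extDerivOne_eq (S.diffCovecAt_eta x) hX hY

lemma IsAlmostContactMetric.extDerivTwo_fundamentalForm (h : IsAlmostContactMetric g S) {x : M}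
    {X Y Z : Π y : M, TangentSpace I y} (hX : DiffAt I X x) (hY : DiffAt I Y x)
    (hZ : DiffAt I Z x) :
    extDerivTwo I (fundamentalForm I g.inner S.Φ) X Y Z x
      = dTwo (fundamentalForm I g.inner S.Φ) x (X x) (Y x) (Z x) :=
  have : CompleteSpace E := FiniteDimensional.complete ℝ E
  extDerivTwo_eq (diffFormAt_fundamentalForm g S x) (h.fundamentalForm_skew x) hX hY hZ

lemma isNormal_iff : IsNormal S ↔ ∀ x u v, normality S x u v = 0 := by
  have : CompleteSpace E := FiniteDimensional.complete ℝ E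
  have e : ∀ x (X Y : Π y : M, TangentSpace I y), DiffAt I X x → DiffAt I Y x →
      nijenhuis I S.Φ X Y x + extDerivOne I S.η X Y x • S.ξ x = normality S x (X x) (Y x) := by
    intro x X Y hX hY
    rw [nijenhuis_eq (S.smooth_Φ.diffEndAt x) hX hY, extDerivOne_eta S hX hY]
    rfl
  constructor
  · intro hN x u v
    have k := hN x _ _ (diffAt_constVec I x u) (diffAt_constVec I x v)
    rwa [e x _ _ (diffAt_constVec I x u) (diffAt_constVec I x v), constVec_self,
      constVec_self] at k
  · intro hN x X Y hX hY
    rw [e x X Y hX hY, hN]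

lemma IsAlmostContactMetric.sharp_eta (h : IsAlmostContactMetric g S) (x : M) :
    sharp g x (S.η x) = S.ξ x := by
  rw [← sub_eq_zero]
  refine metric_nondegenerate g x _ fun w ↦ ?_
  rw [form_sub_left, inner_sharp, h.inner_xi, sub_self]

lemma IsAlmostContactMetric.torsionDerivOne_eta_iff (h : IsAlmostContactMetric g S) (x : M) :
    (∀ X Y : Π y : M, TangentSpace I y, DiffAt I X x → DiffAt I Y x →
      torsionDerivOne g T S.η X Y x = 2 * fundamentalForm I g.inner S.Φ x (X x) (Y x)) ↔
    ∀ u v, T.toFun x (S.ξ x) u v = -thetaAt g S x u v := by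
  have e : ∀ X Y : Π y : M, TangentSpace I y, DiffAt I X x → DiffAt I Y x →
      (torsionDerivOne g T S.η X Y x = 2 * fundamentalForm I g.inner S.Φ x (X x) (Y x) ↔
        T.toFun x (S.ξ x) (X x) (Y x) = -thetaAt g S x (X x) (Y x)) := by
    intro X Y hX hY
    unfold torsionDerivOne thetaAt
    rw [extDerivOne_eta S hX hY, h.sharp_eta]
    constructor <;> intro k <;> linarith
  constructor
  · intro k u v
    have hu := diffAt_constVec I x u
    have hv := diffAt_constVec I x v
    simpa only [constVec_self] using (e _ _ hu hv).1 (k _ _ hu hv)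
  · exact fun k X Y hX hY ↦ (e X Y hX hY).2 (k _ _)

lemma IsAlmostContactMetric.xi_contract_iff (h : IsAlmostContactMetric g S) (x : M) :
    (∀ Y Z : Π y : M, TangentSpace I y, DiffAt I Y x → DiffAt I Z x →
      extDerivTwo I (fundamentalForm I g.inner S.Φ) S.ξ Y Z x = 0) ↔
    ∀ u v, dTwo (fundamentalForm I g.inner S.Φ) x (S.ξ x) u v = 0 := by
  have hξ := S.diffAt_xi x
  constructor
  · intro k u v
    have k' := k _ _ (diffAt_constVec I x u) (diffAt_constVec I x v)
    rwa [h.extDerivTwo_fundamentalForm hξ (diffAt_constVec I x u) (diffAt_constVec I x v),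
      constVec_self, constVec_self] at k'
  · intro k Y Z hY hZ
    rw [h.extDerivTwo_fundamentalForm hξ hY hZ, k]

lemma IsAlmostContactMetric.hasBismutTorsionOnContact_iff (h : IsAlmostContactMetric g S) :
    HasBismutTorsionOnContact g T S ↔ ∀ x u v w, S.η x u = 0 → S.η x v = 0 → S.η x w = 0 →
      T.toFun x u v w =
        dTwo (fundamentalForm I g.inner S.Φ) x (S.Φ x u) (S.Φ x v) (S.Φ x w) := by
  have e : ∀ x (X Y Z : Π y : M, TangentSpace I y), DiffAt I X x → DiffAt I Y x → DiffAt I Z x →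
      extDerivTwo I (fundamentalForm I g.inner S.Φ)
          (fun y ↦ S.Φ y (X y)) (fun y ↦ S.Φ y (Y y)) (fun y ↦ S.Φ y (Z y)) x =
        dTwo (fundamentalForm I g.inner S.Φ) x (S.Φ x (X x)) (S.Φ x (Y x)) (S.Φ x (Z x)) := by
    intro x X Y Z hX hY hZ
    have hΦ := S.smooth_Φ.diffEndAt x
    exact h.extDerivTwo_fundamentalForm (hΦ.diffAt_apply hX) (hΦ.diffAt_apply hY)
      (hΦ.diffAt_apply hZ)
  constructor
  · intro k x u v w hu hv hw
    have k' := k x _ _ _ (diffAt_constVec I x u) (diffAt_constVec I x v) (diffAt_constVec I x w)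
    rw [e x _ _ _ (diffAt_constVec I x u) (diffAt_constVec I x v) (diffAt_constVec I x w),
      constVec_self, constVec_self, constVec_self] at k'
    exact k' hu hv hw
  · intro k x X Y Z hX hY hZ hu hv hw
    rw [e x X Y Z hX hY hZ]
    exact k x _ _ _ hu hv hw

/-- The type of `T` is that of the Bismut torsion of the cone, restricted to horizontal vectors. -/
lemma IsSTConeStructure.torsion_type (hST : IsSTConeStructure g T J) (hJ : InducesOnCone S J)
    (x : M) (u v w : TangentSpace I x) :
    T.toFun x u v w = T.toFun x u (S.Φ x v) (S.Φ x w) + T.toFun x (S.Φ x u) v (S.Φ x w)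
      + T.toFun x (S.Φ x u) (S.Φ x v) w := by
  have key : ∀ (p : Cone M) (u v w : TangentSpace I p.1),
      T.toFun p.1 u v w = T.toFun p.1 u (S.Φ p.1 v) (S.Φ p.1 w)
        + T.toFun p.1 (S.Φ p.1 u) v (S.Φ p.1 w) + T.toFun p.1 (S.Φ p.1 u) (S.Φ p.1 v) w := by
    intro p u v w
    have k := IsKT.torsion_type hST (diffFormAt_coneMetric g) (coneMetric_symm g)
      (coneMetric_nondegenerate g) (coneVec p u 0) (coneVec p v 0) (coneVec p w 0)
    simp only [coneTorsion_apply, hJ.dproj_apply, dproj_coneVec, dr_coneVec, zero_div, zero_smul,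
      add_zero] at k
    refine mul_left_cancel₀ (pow_pos (radius_pos p) 2).ne' ?_
    linear_combination k
  exact key (unitPoint x) u v w

/-- For a triple and the endomorphism field it induces on the cone, the two notions agree. -/
theorem InducesOnCone.isSTConeStructure_iff (hJ : InducesOnCone S J) :
    IsSTConeStructure g T J ↔ IsNormalTContactBismut g T S := by
  have hKT := isKT_iff (J := J) (B := coneTorsion I T.toFun) (diffFormAt_coneMetric g)
    (coneMetric_symm g) (coneMetric_nondegenerate g)
  constructor
  · intro hST
    obtain ⟨-, hsq, hher, -, hN, hB⟩ := hKT.1 hST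
    have h := hJ.hermitian_iff.1 ⟨hsq, hher⟩
    have hn := (hJ.nijenhuisAt_eq_zero_iff h).1 hN
    have hK := fun x ↦ (torsionEquation_iff h (hn x)).1 ((hJ.torsion_eq_iff h).1 hB x)
    exact ⟨⟨h, fun x ↦ (h.torsionDerivOne_eta_iff x).2 (hK x).1,
      fun x ↦ (h.xi_contract_iff x).2 (hK x).2.1, hST.torsion_type hJ⟩, isNormal_iff.2 hn,
      h.hasBismutTorsionOnContact_iff.2 fun x ↦ (hK x).2.2⟩
  · rintro ⟨⟨h, hη, hξ, -⟩, hn, hb⟩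
    have hn' := isNormal_iff.1 hn
    have hsq := hJ.hermitian_iff.2 h
    refine hKT.2 ⟨hJ.smoothEndo, hsq.1, hsq.2, coneTorsion_totallySkew T,
      (hJ.nijenhuisAt_eq_zero_iff h).2 hn', (hJ.torsion_eq_iff h).2 fun x ↦
        (torsionEquation_iff h (hn' x)).2 ⟨(h.torsionDerivOne_eta_iff x).1 (hη x),
          (h.xi_contract_iff x).1 (hξ x), h.hasBismutTorsionOnContact_iff.1 hb x⟩⟩

end Correspondence

end STGeom

end

/-- `(M, g, T)` is a Sasaki-with-torsion manifold if and only if it carries a normal T-contact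
metric structure whose torsion restricted to the contact distribution is a Bismut torsion; and the
Kähler-with-torsion structures on the cone and the contact structures on `M` correspond to each
other through `J(r ∂_r) = ξ`, `J(X) = Φ(X) - r η(X) ∂_r`. -/
theorem proposition2p4 {E : Type*} [NormedAddCommGroup E] [NormedSpace ℝ E] [FiniteDimensional ℝ E]
    {M : Type*} [TopologicalSpace M] [ChartedSpace E M] [IsManifold 𝓘(ℝ, E) ∞ M]
    [T2Space M] [SecondCountableTopology M]
    (g : ContMDiffRiemannianMetric 𝓘(ℝ, E) ∞ E (fun y : M ↦ TangentSpace 𝓘(ℝ, E) y))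
    (T : STGeom.ThreeForm 𝓘(ℝ, E) M) :
    (STGeom.IsSTManifold g T ↔
      ∃ S : STGeom.ContactTriple 𝓘(ℝ, E) M, STGeom.IsNormalTContactBismut g T S) ∧
    ∀ J : Π p : STGeom.Cone M, TangentSpace (STGeom.coneModel 𝓘(ℝ, E)) p →L[ℝ]
        TangentSpace (STGeom.coneModel 𝓘(ℝ, E)) p,
      STGeom.IsSTConeStructure g T J ↔
        ∃ S : STGeom.ContactTriple 𝓘(ℝ, E) M,
          STGeom.IsNormalTContactBismut g T S ∧ STGeom.InducesOnCone S J := by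
  have key : ∀ J, STGeom.IsSTConeStructure g T J ↔
      ∃ S, STGeom.IsNormalTContactBismut g T S ∧ STGeom.InducesOnCone S J := by
    intro J
    constructor
    · intro h
      obtain ⟨S, hS⟩ := h.exists_inducesOnCone
      exact ⟨S, hS.isSTConeStructure_iff.1 h, hS⟩
    · rintro ⟨S, h, hS⟩
      exact hS.isSTConeStructure_iff.2 h
  refine ⟨⟨fun ⟨J, hJ⟩ ↦ ?_, fun ⟨S, h⟩ ↦ ?_⟩, key⟩
  · obtain ⟨S, h, -⟩ := (key J).1 hJ
    exact ⟨S, h⟩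
  · exact ⟨STGeom.coneEndo S, (key _).2 ⟨S, h, STGeom.inducesOnCone_coneEndo S⟩⟩
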